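/- A Jordan domain is a subset $D\subseteq\mathbb{R}^2$ homeomorphic to the closed unit disk. Write $I=[0,1]$ and let $\partial D$ denote the boundary of $D$. A sensor curve in $D$ is a continuous map $f\colon I\times I\to D$ such that (i) for every $t\in(0,1)$ the curve $f(\cdot,t)\colon I\to D$ is rectifiable and injective; (ii) $f(\cdot,0)$ and $f(\cdot,1)$ are constant maps, with values in $\partial D$; (iii) $f(s,t)\in\partial D$ if and only if $s\in\{0,1\}$ or $t\in\{0,1\}$. Its length is $L(f)=\sup_{t\in I}L(f(\cdot,t))$, where $L$ denotes the length of a curve. A sensor curve $f$ is a sweep of $D$ if for every continuous $\gamma\colon I\to D$ there is a $t\in I$ with $\gamma(t)\in f(I,t)$. The sweeping cost $\mathrm{SC}(D)$ is the infimum of $L(f)$ over all sweeps $f$ of $D$. Corollary. Let $D$ be a convex Jordan domain. Then $$\mathrm{area}(D)\ \ge\ \frac{\mathrm{SC}(D)^2}{\sqrt3},$$ with equality if $D$ is a (closed, filled, non-degenerate) equilateral triangle. Hence, for every $A>0$, there is an equilateral triangle of area $A$, and each such triangle has the maximal sweeping cost among all convex Jordan domains of area $A$. -/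

import Mathlib

open MeasureTheory

open scoped ENNReal

/-- The Euclidean plane. -/
abbrev Plane : Type := EuclideanSpace ℝ (Fin 2)

/-- A Jordan domain: a subset of the plane homeomorphic to the closed unit disk. -/
def IsJordanDomain (D : Set Plane) : Prop :=
  Nonempty (D ≃ₜ Metric.closedBall (0 : Plane) 1)

/-- A sensor curve in `D`: a continuous map `I × I → D`, `(s, t) ↦ f s t`, with `s` the spatial and
`t` the temporal variable.  It lies on the boundary of `D` exactly at the two ends of the curve and
at the initial and final times. -/
structure IsSensorCurve (D : Set Plane) (f : unitInterval → unitInterval → Plane) : Prop where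
  continuous : Continuous (fun p : unitInterval × unitInterval => f p.1 p.2)
  mem : ∀ s t, f s t ∈ D
  rectifiable : ∀ t, 0 < t → t < 1 → eVariationOn (fun s => f s t) Set.univ ≠ ∞
  injective : ∀ t, 0 < t → t < 1 → Function.Injective (fun s => f s t)
  start : ∃ p ∈ frontier D, ∀ s, f s 0 = p
  finish : ∃ p ∈ frontier D, ∀ s, f s 1 = p
  mem_frontier_iff : ∀ s t, f s t ∈ frontier D ↔ (s = 0 ∨ s = 1) ∨ (t = 0 ∨ t = 1)

/-- A sweep of `D`: a sensor curve that catches every continuously moving intruder in `D`. -/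
def IsSweep (D : Set Plane) (f : unitInterval → unitInterval → Plane) : Prop :=
  IsSensorCurve D f ∧
    ∀ γ : unitInterval → Plane, Continuous γ → (∀ t, γ t ∈ D) → ∃ t s, γ t = f s t

/-- The length of a sensor curve: the supremum over all times of the length of the curve `f(·, t)`
(its total variation, i.e. the supremum of the lengths of inscribed polygons). -/
noncomputable def sensorLength (f : unitInterval → unitInterval → Plane) : ℝ≥0∞ :=
  ⨆ t, eVariationOn (fun s => f s t) Set.univ

/-- The sweeping cost of `D`: the infimum of the lengths of all sweeps of `D`, in `[0, ∞]`. -/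
noncomputable def sweepingCost (D : Set Plane) : ℝ≥0∞ :=
  ⨅ (f : unitInterval → unitInterval → Plane) (_ : IsSweep D f), sensorLength f

/-- A (closed, filled, non-degenerate) equilateral triangle. -/
def IsEquilateralTriangle (T : Set Plane) : Prop :=
  ∃ a b c : Plane, 0 < dist a b ∧ dist b c = dist a b ∧ dist c a = dist a b ∧
    T = convexHull ℝ {a, b, c}

/-! The inequality combines two estimates through the minimal width `w` of `D`. A convex body can be
swept by parallel chords. A chord nearly parallel to a unit vector `n` is hardly longer than its
projection to the `n`-axis, so the cost is at most the width in direction `n`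
(`sweepingCost_le_width`). The end chords must be single points; this holds for almost every
direction, because the support function is Lipschitz and hence almost everywhere differentiable, and
a limit of directions gives the rest. Pál's inequality `area ≥ w² / √3` (`pal_inequality`) starts
from a largest inscribed disk, of radius `r`, whose contact normals have `0` in their convex hull.
If `w ≤ 2r`, the disk alone is large enough. Otherwise there are three contact normals, and opposite
to each a point of `D` at distance at least `w - r` from the centre. The caps that these points span
with the disk are disjoint, and disk and caps together have at least the area of an explicit hexagon
(`le_volume_of_disk_of_points`). For an equilateral triangle of side `ℓ`, a sensor curve whose
endpoints never meet all three sides at one time is evaded by an intruder moving along the boundary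
(`IsEquilateral.exists_coord_eq_zero_of_isSweep`). So at some time the endpoints meet all three
sides, which makes one of them a vertex and puts the other on the opposite side; the length is then
at least the altitude `√3 / 2 * ℓ` (`IsEquilateral.le_sweepingCost`). The area equals altitude
squared over `√3`, which gives equality and hence the extremality. -/

/-! ### Areas of triangles. -/

/-- The open triangle with vertices `0`, `x`, `y`. -/
def openTriangle (x y : Plane) : Set Plane :=
  {p | ∃ a b : ℝ, 0 < a ∧ 0 < b ∧ a + b < 1 ∧ p = a • x + b • y}

/-- The signed area of the parallelogram spanned by two plane vectors. -/
def cross (x y : Plane) : ℝ := x 0 * y 1 - x 1 * y 0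

lemma volume_standard_triangle :
    volume {p : ℝ × ℝ | 0 < p.1 ∧ 0 < p.2 ∧ p.1 + p.2 < 1} = ENNReal.ofReal (1 / 2) := by
  have h := volume_regionBetween_eq_integral (μ := (volume : Measure ℝ)) (f := fun _ => (0 : ℝ))
    (g := fun x => 1 - x) (s := Set.Ioo (0 : ℝ) 1) (by
      exact (continuous_const.integrableOn_Icc (a := (0:ℝ)) (b := 1)).mono_set Set.Ioo_subset_Icc_self)
    (by
      exact ((continuous_const.sub continuous_id).integrableOn_Icc (a := (0:ℝ)) (b := 1)).mono_set
        Set.Ioo_subset_Icc_self)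
    measurableSet_Ioo (fun x hx => by linarith [hx.2])
  have e : {p : ℝ × ℝ | 0 < p.1 ∧ 0 < p.2 ∧ p.1 + p.2 < 1} =
      regionBetween (fun _ => (0 : ℝ)) (fun x => 1 - x) (Set.Ioo (0 : ℝ) 1) := by
    ext ⟨a, b⟩
    simp only [regionBetween, Set.mem_ofPred_eq, Set.mem_Ioo]
    constructor
    · rintro ⟨h1, h2, h3⟩
      exact ⟨⟨h1, by linarith⟩, h2, by linarith⟩
    · rintro ⟨⟨h1, h2⟩, h3, h4⟩
      exact ⟨h1, h3, by linarith⟩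
  rw [e, Measure.volume_eq_prod, h]
  congr 1
  rw [← MeasureTheory.integral_Ioc_eq_integral_Ioo, ← intervalIntegral.integral_of_le zero_le_one]
  simp only [Pi.sub_apply, sub_zero]
  rw [intervalIntegral.integral_sub (by simp) (by simp)]
  simp
  norm_num

lemma volume_openTriangle_standard :
    volume (openTriangle (EuclideanSpace.single 0 1) (EuclideanSpace.single 1 1)) =
      ENNReal.ofReal (1 / 2) := by
  rw [← volume_standard_triangle]
  have h1 := (EuclideanSpace.volume_preserving_symm_measurableEquiv_toLp (Fin 2))
  have h2 := volume_preserving_finTwoArrow ℝ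
  have h := h2.comp h1
  have hm : MeasurableSet {p : ℝ × ℝ | 0 < p.1 ∧ 0 < p.2 ∧ p.1 + p.2 < 1} := by
    apply IsOpen.measurableSet
    exact (isOpen_lt continuous_const continuous_fst).inter
      ((isOpen_lt continuous_const continuous_snd).inter
        (isOpen_lt (continuous_fst.add continuous_snd) continuous_const))
  rw [← h.measure_preimage hm.nullMeasurableSet]
  congr 1
  ext p
  simp only [openTriangle, Set.mem_ofPred_eq, Set.mem_preimage, Function.comp]
  constructor
  · rintro ⟨a, b, ha, hb, hab, rfl⟩
    simpa using ⟨ha, hb, hab⟩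
  · intro hp
    refine ⟨p 0, p 1, hp.1, hp.2.1, hp.2.2, ?_⟩
    ext i
    fin_cases i <;> simp

/-- The triangle is the image of the standard one under the matrix with columns `x`, `y`, whose
determinant is `cross x y`; degenerate triangles are covered too. -/
lemma volume_openTriangle (x y : Plane) :
    volume (openTriangle x y) = ENNReal.ofReal (|cross x y| / 2) := by
  have e : openTriangle x y =
      (Matrix.toEuclideanLin !![x 0, y 0; x 1, y 1]) ''
        openTriangle (EuclideanSpace.single 0 1) (EuclideanSpace.single 1 1) := by
    have h0 : (Matrix.toEuclideanLin !![x 0, y 0; x 1, y 1]) (EuclideanSpace.single 0 1) = x := by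
      ext i
      fin_cases i <;> simp [Matrix.toLpLin_apply]
    have h1 : (Matrix.toEuclideanLin !![x 0, y 0; x 1, y 1]) (EuclideanSpace.single 1 1) = y := by
      ext i
      fin_cases i <;> simp [Matrix.toLpLin_apply]
    ext p
    constructor
    · rintro ⟨a, b, ha, hb, hab, rfl⟩
      exact ⟨_, ⟨a, b, ha, hb, hab, rfl⟩, by rw [map_add, map_smul, map_smul, h0, h1]⟩
    · rintro ⟨_, ⟨a, b, ha, hb, hab, rfl⟩, rfl⟩
      exact ⟨a, b, ha, hb, hab, by rw [map_add, map_smul, map_smul, h0, h1]⟩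
  rw [e, Measure.addHaar_image_linearMap, volume_openTriangle_standard,
    ← ENNReal.ofReal_mul (abs_nonneg _)]
  have hdet : LinearMap.det (Matrix.toEuclideanLin !![x 0, y 0; x 1, y 1]) = cross x y := by
    rw [Matrix.toEuclideanLin_eq_toLin_orthonormal, LinearMap.det_toLin, Matrix.det_fin_two, cross]
    simp
    ring
  rw [hdet]
  congr 1
  ring

lemma cross_sq (x y : Plane) : cross x y ^ 2 = ‖x‖ ^ 2 * ‖y‖ ^ 2 - inner ℝ x y ^ 2 := by
  simp only [cross, EuclideanSpace.norm_sq_eq, PiLp.inner_apply, Fin.sum_univ_two, Real.norm_eq_abs,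
    sq_abs, RCLike.inner_apply, conj_trivial]
  ring

/-! ### Metric geometry of equilateral triangles in barycentric coordinates. -/

/-- Three points of the plane at mutual distance `ℓ`. -/
structure IsEquilateral (V : Fin 3 → Plane) (ℓ : ℝ) : Prop where
  pos : 0 < ℓ
  dist_eq : ∀ i j, i ≠ j → dist (V i) (V j) = ℓ

lemma sq_le_sum_sq_of_sum_eq_zero (w : Fin 3 → ℝ) (hw : ∑ i, w i = 0) (i : Fin 3) :
    3 / 2 * w i ^ 2 ≤ ∑ i, w i ^ 2 := by
  rw [Fin.sum_univ_three] at hw ⊢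
  have h0 : w 0 = - w 1 - w 2 := by linarith
  rw [h0]
  fin_cases i <;> simp only [Fin.zero_eta, Fin.mk_one, Fin.reduceFinMk, h0] <;>
  nlinarith [sq_nonneg (w 1 - w 2), sq_nonneg (w 1 + 2 * w 2), sq_nonneg (2 * w 1 + w 2)]

namespace IsEquilateral

variable {V : Fin 3 → Plane} {ℓ : ℝ}

lemma inner_edges (h : IsEquilateral V ℓ) : inner ℝ (V 1 - V 0) (V 2 - V 0) = ℓ ^ 2 / 2 := by
  have h1 := h.dist_eq 1 0 (by decide)
  have h2 := h.dist_eq 2 0 (by decide)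
  have h3 := h.dist_eq 1 2 (by decide)
  rw [dist_eq_norm] at h1 h2 h3
  have h4 := norm_sub_sq_real (V 1 - V 0) (V 2 - V 0)
  rw [sub_sub_sub_cancel_right, h1, h2, h3] at h4
  linarith

/-- In barycentric coordinates the Euclidean metric of an equilateral triangle is a multiple of the
standard one; affine independence and the altitude bound both follow from this. -/
lemma norm_sq_sum (h : IsEquilateral V ℓ) (w : Fin 3 → ℝ) (hw : ∑ i, w i = 0) :
    ‖∑ i, w i • V i‖ ^ 2 = ℓ ^ 2 / 2 * ∑ i, w i ^ 2 := by
  have h1 := h.dist_eq 1 0 (by decide)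
  have h2 := h.dist_eq 2 0 (by decide)
  rw [dist_eq_norm] at h1 h2
  rw [Fin.sum_univ_three] at hw
  have e : ∑ i, w i • V i = w 1 • (V 1 - V 0) + w 2 • (V 2 - V 0) := by
    have h0 : w 0 = - w 1 - w 2 := by linarith
    rw [Fin.sum_univ_three, h0]
    module
  have h0 : w 0 = - w 1 - w 2 := by linarith
  rw [e, norm_add_sq_real, norm_smul, norm_smul, real_inner_smul_left, real_inner_smul_right,
    h.inner_edges, h1, h2, mul_pow, mul_pow, Real.norm_eq_abs, Real.norm_eq_abs, sq_abs, sq_abs,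
    Fin.sum_univ_three, h0]
  ring

lemma affineIndependent (h : IsEquilateral V ℓ) : AffineIndependent ℝ V := by
  rw [affineIndependent_iff_of_fintype]
  intro w hw hs i
  rw [Finset.weightedVSub_eq_linear_combination _ hw] at hs
  have h1 := h.norm_sq_sum w hw
  rw [hs, norm_zero] at h1
  have h2 : ∑ i, w i ^ 2 = 0 := by
    have := h.pos
    have h3 : ℓ ^ 2 / 2 ≠ 0 := by positivity
    have h4 : ℓ ^ 2 / 2 * ∑ i, w i ^ 2 = 0 := by rw [← h1]; simp
    exact (mul_eq_zero.1 h4).resolve_left h3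
  have := (Finset.sum_eq_zero_iff_of_nonneg (fun i _ => sq_nonneg (w i))).1 h2 i (Finset.mem_univ i)
  exact pow_eq_zero_iff two_ne_zero |>.1 this

/-- The vertices of an equilateral triangle as an affine basis of the plane. -/
noncomputable def affineBasis (h : IsEquilateral V ℓ) : AffineBasis (Fin 3) ℝ Plane where
  toFun := V
  ind' := h.affineIndependent
  tot' := by
    rw [h.affineIndependent.affineSpan_eq_top_iff_card_eq_finrank_add_one]
    simp

@[simp] lemma coe_affineBasis (h : IsEquilateral V ℓ) : ⇑h.affineBasis = V := rfl

/-- Each barycentric coordinate is the distance to a side divided by the altitude `√3 / 2 * ℓ`, so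
it is Lipschitz with the reciprocal constant. -/
lemma coord_sub_le (h : IsEquilateral V ℓ) (i : Fin 3) (p q : Plane) :
    √3 / 2 * ℓ * |h.affineBasis.coord i p - h.affineBasis.coord i q| ≤ dist p q := by
  set b := h.affineBasis
  have hp := b.linear_combination_coord_eq_self p
  have hq := b.linear_combination_coord_eq_self q
  have hw : ∑ i, (b.coord i p - b.coord i q) = 0 := by
    rw [Finset.sum_sub_distrib, b.sum_coord_apply_eq_one, b.sum_coord_apply_eq_one, sub_self]
  have h1 := h.norm_sq_sum (fun i => b.coord i p - b.coord i q) hw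
  have h2 : ∑ i, (b.coord i p - b.coord i q) • V i = p - q := by
    conv_rhs => rw [← hp, ← hq, ← Finset.sum_sub_distrib]
    exact Finset.sum_congr rfl fun i _ => sub_smul _ _ _
  rw [h2, ← dist_eq_norm] at h1
  have hpos := h.pos
  apply le_of_sq_le_sq _ dist_nonneg
  rw [h1, mul_pow, mul_pow, sq_abs, div_pow, Real.sq_sqrt (by norm_num)]
  have key := sq_le_sum_sq_of_sum_eq_zero _ hw i
  nlinarith [sq_nonneg ℓ]

end IsEquilateral

/-! ### Lower bound for the sweeping cost of an equilateral triangle. -/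

namespace IsEquilateral

variable {V : Fin 3 → Plane} {ℓ : ℝ}

lemma mem_triangle_iff (h : IsEquilateral V ℓ) {p : Plane} :
    p ∈ convexHull ℝ (Set.range V) ↔ ∀ i, 0 ≤ h.affineBasis.coord i p := by
  have := h.affineBasis.convexHull_eq_nonneg_coord
  rw [coe_affineBasis] at this
  rw [this]
  rfl

lemma interior_triangle (h : IsEquilateral V ℓ) :
    interior (convexHull ℝ (Set.range V)) = {p | ∀ i, 0 < h.affineBasis.coord i p} := by
  have := h.affineBasis.interior_convexHull
  rwa [coe_affineBasis] at this

lemma isCompact_triangle (V : Fin 3 → Plane) : IsCompact (convexHull ℝ (Set.range V)) :=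
  (Set.finite_range V).isCompact_convexHull ℝ

lemma mem_frontier_triangle_iff (h : IsEquilateral V ℓ) {p : Plane} :
    p ∈ frontier (convexHull ℝ (Set.range V)) ↔
      p ∈ convexHull ℝ (Set.range V) ∧ ∃ i, h.affineBasis.coord i p = 0 := by
  rw [(isCompact_triangle V).isClosed.frontier_eq, h.interior_triangle, Set.mem_sdiff]
  refine and_congr_right fun hp => ?_
  rw [h.mem_triangle_iff] at hp
  simp only [Set.mem_ofPred_eq, not_forall, not_lt]
  exact exists_congr fun i => ⟨fun hi => le_antisymm hi (hp i), fun hi => hi.le⟩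

lemma coord_sum_smul (h : IsEquilateral V ℓ) (w : Fin 3 → ℝ) (hw : ∑ i, w i = 1) (i : Fin 3) :
    h.affineBasis.coord i (∑ j, w j • V j) = w i := by
  have h1 := h.affineBasis.coord_apply_combination_of_mem (Finset.mem_univ i) hw
  rwa [Finset.affineCombination_eq_linear_combination _ _ _ hw] at h1

lemma volume_triangle (h : IsEquilateral V ℓ) :
    volume (convexHull ℝ (Set.range V)) = ENNReal.ofReal (√3 / 4 * ℓ ^ 2) := by
  have hf := (convex_convexHull ℝ (Set.range V)).addHaar_frontier (volume : Measure Plane)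
  rw [← measure_sdiff_null hf, self_sdiff_frontier, h.interior_triangle]
  have e : {p | ∀ i, 0 < h.affineBasis.coord i p} =
      (fun p => p - V 0) ⁻¹' openTriangle (V 1 - V 0) (V 2 - V 0) := by
    ext p
    simp only [Set.mem_ofPred_eq, Set.mem_preimage, openTriangle]
    constructor
    · intro hp
      have h1 := h.affineBasis.linear_combination_coord_eq_self p
      have h2 := h.affineBasis.sum_coord_apply_eq_one p
      rw [Fin.sum_univ_three] at h1 h2
      rw [coe_affineBasis] at h1
      refine ⟨_, _, hp 1, hp 2, by linarith [hp 0], ?_⟩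
      have h3 : h.affineBasis.coord 0 p = 1 - h.affineBasis.coord 1 p - h.affineBasis.coord 2 p := by
        linarith
      rw [h3] at h1
      conv_lhs => rw [← h1]
      module
    · rintro ⟨a, b, ha, hb, hab, hp⟩
      have hp' : p = ∑ j, (![1 - a - b, a, b] : Fin 3 → ℝ) j • V j := by
        rw [sub_eq_iff_eq_add] at hp
        rw [hp, Fin.sum_univ_three]
        simp only [Matrix.cons_val]
        module
      intro i
      rw [hp', h.coord_sum_smul _ (by simp [Fin.sum_univ_three]; ring)]
      fin_cases i <;> simp <;> linarith
  rw [e]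
  simp only [sub_eq_add_neg _ (V 0)]
  rw [measure_preimage_add_right, ← sub_eq_add_neg, ← sub_eq_add_neg, volume_openTriangle]
  congr 1
  have h1 := h.dist_eq 1 0 (by decide)
  have h2 := h.dist_eq 2 0 (by decide)
  rw [dist_eq_norm] at h1 h2
  have h3 := cross_sq (V 1 - V 0) (V 2 - V 0)
  rw [h1, h2, h.inner_edges] at h3
  have h4 : |cross (V 1 - V 0) (V 2 - V 0)| = √3 / 2 * ℓ ^ 2 := by
    rw [← abs_of_nonneg (show 0 ≤ √3 / 2 * ℓ ^ 2 by positivity), ← sq_eq_sq_iff_abs_eq_abs, h3,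
      mul_pow, div_pow √3, Real.sq_sqrt (by norm_num)]
    ring
  rw [h4]
  ring

/-- By pigeonhole one of the two points has two vanishing coordinates, so its third is `1`; there
the other point must vanish. -/
lemma exists_coord_sub_eq_one (h : IsEquilateral V ℓ) {p q : Plane}
    (hpq : ∀ i, h.affineBasis.coord i p = 0 ∨ h.affineBasis.coord i q = 0) :
    ∃ i, |h.affineBasis.coord i p - h.affineBasis.coord i q| = 1 := by
  have hp := h.affineBasis.sum_coord_apply_eq_one p
  have hq := h.affineBasis.sum_coord_apply_eq_one q
  rw [Fin.sum_univ_three] at hp hq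
  rcases hpq 0 with h0 | h0 <;> rcases hpq 1 with h1 | h1 <;> rcases hpq 2 with h2 | h2 <;>
    simp only [h0, h1, h2, zero_add, add_zero, zero_ne_one] at hp hq
  · exact ⟨2, by rw [h2, hp]; simp⟩
  · exact ⟨1, by rw [h1, hp]; simp⟩
  · exact ⟨0, by rw [h0, hq]; simp⟩
  · exact ⟨0, by rw [h0, hp]; simp⟩
  · exact ⟨1, by rw [h1, hq]; simp⟩
  · exact ⟨2, by rw [h2, hq]; simp⟩

/-- If no sensor curve has endpoints meeting all three sides, an intruder evades on the boundary. -/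
lemma exists_coord_eq_zero_of_isSweep (h : IsEquilateral V ℓ)
    {f : unitInterval → unitInterval → Plane} (hf : IsSweep (convexHull ℝ (Set.range V)) f) :
    ∃ t, ∀ i, h.affineBasis.coord i (f 0 t) = 0 ∨ h.affineBasis.coord i (f 1 t) = 0 := by
  by_contra! hcon
  obtain ⟨hs, hsw⟩ := hf
  set b := h.affineBasis with hb
  -- Up to the factor of the altitude, `d i t` is the distance from side `i` to the nearer endpoint
  -- of the curve at time `t`.
  let d : Fin 3 → unitInterval → ℝ := fun i t => min (b.coord i (f 0 t)) (b.coord i (f 1 t))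
  have hcont : ∀ s, Continuous (f s) := fun s =>
    hs.continuous.comp (continuous_const.prodMk continuous_id)
  have hd : ∀ i, Continuous (d i) := fun i =>
    ((continuous_barycentric_coord b i).comp (hcont 0)).min ((continuous_barycentric_coord b i).comp (hcont 1))
  have hnn : ∀ i s t, 0 ≤ b.coord i (f s t) := fun i s t => h.mem_triangle_iff.1 (hs.mem s t) i
  let M : unitInterval → ℝ := fun t => max (max (d 0 t) (d 1 t)) (d 2 t)
  have hM : Continuous M := ((hd 0).max (hd 1)).max (hd 2)
  have hdM : ∀ i t, d i t ≤ M t := by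
    intro i t
    fin_cases i
    · exact (le_max_left _ _).trans (le_max_left _ _)
    · exact (le_max_right _ _).trans (le_max_left _ _)
    · exact le_max_right _ _
  have hMpos : ∀ t, 0 < M t := by
    intro t
    obtain ⟨i, hi0, hi1⟩ := hcon t
    exact (lt_min ((hnn i 0 t).lt_of_ne' hi0) ((hnn i 1 t).lt_of_ne' hi1)).trans_le (hdM i t)
  have hex : ∀ t, ∃ k, d k t = M t := by
    intro t
    rcases max_choice (max (d 0 t) (d 1 t)) (d 2 t) with h1 | h1
    · rcases max_choice (d 0 t) (d 1 t) with h2 | h2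
      · exact ⟨0, by rw [← h2, ← h1]⟩
      · exact ⟨1, by rw [← h2, ← h1]⟩
    · exact ⟨2, by rw [← h1]⟩
  let S : unitInterval → ℝ := fun t => ∑ i, (M t - d i t)
  have hScont : Continuous S := continuous_finsetSum _ fun i _ => hM.sub (hd i)
  have hSpos : ∀ t, 0 < S t := by
    intro t
    have h0 : f 0 t ∈ frontier (convexHull ℝ (Set.range V)) :=
      (hs.mem_frontier_iff 0 t).2 (Or.inl (Or.inl rfl))
    obtain ⟨-, j, hj⟩ := h.mem_frontier_triangle_iff.1 h0
    refine Finset.sum_pos' (fun i _ => sub_nonneg.2 (hdM i t)) ⟨j, Finset.mem_univ j, ?_⟩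
    have : d j t ≤ 0 := (min_le_left _ _).trans hj.le
    linarith [hMpos t]
  -- The intruder stays on a side from which both endpoints are away: a side maximizing `d` gets
  -- coordinate `0`. The normalization is legitimate since `f 0 t` lies on some side `j`, where `d j
  -- t ≤ 0 < M t`.
  let γ : unitInterval → Plane := fun t => ∑ i, ((M t - d i t) / S t) • V i
  have hγ : Continuous γ := continuous_finsetSum _ fun i _ =>
    ((hM.sub (hd i)).div hScont fun t => (hSpos t).ne').smul continuous_const
  have hcoord : ∀ i t, b.coord i (γ t) = (M t - d i t) / S t := by
    intro i t
    refine h.coord_sum_smul _ ?_ i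
    rw [← Finset.sum_div]
    exact div_self (hSpos t).ne'
  have hmem : ∀ t, γ t ∈ convexHull ℝ (Set.range V) := by
    intro t
    rw [h.mem_triangle_iff]
    intro i
    rw [← hb, hcoord]
    exact div_nonneg (sub_nonneg.2 (hdM i t)) (hSpos t).le
  obtain ⟨t, s, hts⟩ := hsw γ hγ hmem
  obtain ⟨k, hk⟩ := hex t
  have hk0 : b.coord k (γ t) = 0 := by rw [hcoord, hk, sub_self, zero_div]
  have hfr : f s t ∈ frontier (convexHull ℝ (Set.range V)) := by
    rw [← hts]
    exact h.mem_frontier_triangle_iff.2 ⟨hmem t, k, hk0⟩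
  -- A capture on the boundary happens at an endpoint; at times `0` and `1` this is because the
  -- curve is a single point.
  have hends : f s t = f 0 t ∨ f s t = f 1 t := by
    rcases (hs.mem_frontier_iff s t).1 hfr with (h1 | h1) | (h1 | h1)
    · exact Or.inl (by rw [h1])
    · exact Or.inr (by rw [h1])
    · obtain ⟨p, -, hp⟩ := hs.start
      exact Or.inl (by rw [h1, hp, hp])
    · obtain ⟨p, -, hp⟩ := hs.finish
      exact Or.inl (by rw [h1, hp, hp])
  have hlt : 0 < d k t := hk ▸ hMpos t
  rw [hts] at hk0
  rcases hends with h1 | h1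
  · rw [h1] at hk0
    exact (hlt.trans_le (min_le_left _ _)).ne' hk0
  · rw [h1] at hk0
    exact (hlt.trans_le (min_le_right _ _)).ne' hk0

lemma le_sensorLength (h : IsEquilateral V ℓ)
    {f : unitInterval → unitInterval → Plane} (hf : IsSweep (convexHull ℝ (Set.range V)) f) :
    ENNReal.ofReal (√3 / 2 * ℓ) ≤ sensorLength f := by
  obtain ⟨t, ht⟩ := h.exists_coord_eq_zero_of_isSweep hf
  obtain ⟨i, hi⟩ := h.exists_coord_sub_eq_one ht
  have h1 := h.coord_sub_le i (f 0 t) (f 1 t)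
  rw [hi, mul_one] at h1
  calc ENNReal.ofReal (√3 / 2 * ℓ) ≤ ENNReal.ofReal (dist (f 0 t) (f 1 t)) :=
        ENNReal.ofReal_le_ofReal h1
    _ = edist (f 0 t) (f 1 t) := (edist_dist _ _).symm
    _ ≤ eVariationOn (fun s => f s t) Set.univ :=
        eVariationOn.edist_le (fun s => f s t) (Set.mem_univ 0) (Set.mem_univ 1)
    _ ≤ sensorLength f := le_iSup (fun t => eVariationOn (fun s => f s t) Set.univ) t

lemma le_sweepingCost (h : IsEquilateral V ℓ) :
    ENNReal.ofReal (√3 / 2 * ℓ) ≤ sweepingCost (convexHull ℝ (Set.range V)) :=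
  le_iInf₂ fun _ hf => h.le_sensorLength hf

lemma interior_triangle_nonempty (h : IsEquilateral V ℓ) :
    (interior (convexHull ℝ (Set.range V))).Nonempty := by
  rw [interior_convexHull_nonempty_iff_affineSpan_eq_top]
  exact h.affineBasis.tot

end IsEquilateral

/-! ### Triangles as indexed vertices, and convex Jordan domains as convex bodies. -/

lemma IsEquilateralTriangle.exists_isEquilateral {T : Set Plane} (hT : IsEquilateralTriangle T) :
    ∃ V ℓ, IsEquilateral V ℓ ∧ T = convexHull ℝ (Set.range V) := by
  obtain ⟨a, b, c, h0, h1, h2, rfl⟩ := hT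
  refine ⟨![a, b, c], dist a b, ⟨h0, ?_⟩, ?_⟩
  · have h3 : dist b a = dist a b := dist_comm _ _
    have h4 : dist c b = dist a b := by rw [dist_comm, h1]
    have h5 : dist a c = dist a b := by rw [dist_comm, h2]
    intro i j hij
    fin_cases i <;> fin_cases j <;> simp_all
  · congr 1
    ext p
    simp only [Matrix.range_cons, Matrix.range_empty, Set.mem_insert_iff, Set.mem_singleton_iff,
      Set.mem_union, Set.union_empty]

lemma IsEquilateral.isEquilateralTriangle {V : Fin 3 → Plane} {ℓ : ℝ} (h : IsEquilateral V ℓ) :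
    IsEquilateralTriangle (convexHull ℝ (Set.range V)) := by
  refine ⟨V 0, V 1, V 2, ?_, ?_, ?_, ?_⟩
  · rw [h.dist_eq _ _ (by decide)]; exact h.pos
  · rw [h.dist_eq _ _ (by decide), h.dist_eq _ _ (by decide)]
  · rw [h.dist_eq _ _ (by decide), h.dist_eq _ _ (by decide)]
  · congr 1
    ext p
    simp [Fin.exists_fin_succ, eq_comm]

/-- Makes triangles admissible competitors in the extremal problem. -/
lemma Convex.isJordanDomain {D : Set Plane} (hD : Convex ℝ D) (hc : IsCompact D)
    (hi : (interior D).Nonempty) : IsJordanDomain D := by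
  obtain ⟨h, -, h2, -⟩ := exists_homeomorph_image_interior_closure_frontier_eq_unitBall hD hi
    hc.isBounded
  rw [hc.isClosed.closure_eq] at h2
  exact ⟨(h.image D).trans (Homeomorph.setCongr h2)⟩

lemma IsJordanDomain.isCompact {D : Set Plane} (hD : IsJordanDomain D) : IsCompact D := by
  obtain ⟨e⟩ := hD
  have : CompactSpace (Metric.closedBall (0 : Plane) 1) :=
    isCompact_iff_compactSpace.1 (isCompact_closedBall _ _)
  exact isCompact_iff_compactSpace.2 e.symm.compactSpace

/-- Rotation of the plane by a right angle. -/
def rot (v : Plane) : Plane := !₂[-v 1, v 0]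

@[simp] lemma rot_zero_apply (v : Plane) : rot v 0 = -v 1 := rfl
@[simp] lemma rot_one_apply (v : Plane) : rot v 1 = v 0 := rfl

lemma Plane.inner_eq (x y : Plane) : inner ℝ x y = x 0 * y 0 + x 1 * y 1 := by
  simp only [PiLp.inner_apply, Fin.sum_univ_two, RCLike.inner_apply, conj_trivial]
  ring

lemma Plane.norm_sq_eq (x : Plane) : ‖x‖ ^ 2 = x 0 ^ 2 + x 1 ^ 2 := by
  rw [← real_inner_self_eq_norm_sq, Plane.inner_eq]
  ring

lemma Plane.ext {x y : Plane} (h0 : x 0 = y 0) (h1 : x 1 = y 1) : x = y := by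
  ext i
  fin_cases i
  · exact h0
  · exact h1

lemma norm_sq_smul_eq (v p : Plane) :
    ‖v‖ ^ 2 • p = inner ℝ p v • v + inner ℝ p (rot v) • rot v := by
  apply Plane.ext <;> simp [Plane.inner_eq, Plane.norm_sq_eq] <;> ring

/-- The unit vector at angle `θ`. -/
noncomputable def unitVec (θ : ℝ) : Plane := !₂[Real.cos θ, Real.sin θ]

@[simp] lemma unitVec_zero_apply (θ : ℝ) : unitVec θ 0 = Real.cos θ := rfl
@[simp] lemma unitVec_one_apply (θ : ℝ) : unitVec θ 1 = Real.sin θ := rfl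

@[simp] lemma norm_unitVec (θ : ℝ) : ‖unitVec θ‖ = 1 := by
  have h := Plane.norm_sq_eq (unitVec θ)
  simp only [unitVec_zero_apply, unitVec_one_apply, Real.cos_sq_add_sin_sq] at h
  exact (pow_eq_one_iff_of_nonneg (norm_nonneg _) two_ne_zero).1 h

lemma continuous_unitVec : Continuous unitVec := by
  unfold unitVec
  refine (PiLp.continuous_toLp 2 _).comp (continuous_pi fun i => ?_)
  fin_cases i
  · exact Real.continuous_cos
  · exact Real.continuous_sin

lemma unitVec_add_pi (θ : ℝ) : unitVec (θ + Real.pi) = -unitVec θ := by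
  apply Plane.ext <;> simp

lemma exists_unitVec_eq {n : Plane} (hn : ‖n‖ = 1) : ∃ θ, n = unitVec θ := by
  have h := Plane.norm_sq_eq n
  rw [hn] at h
  set z : ℂ := ⟨n 0, n 1⟩
  have hz : ‖z‖ = 1 := by
    rw [Complex.norm_eq_sqrt_sq_add_sq]
    simp only [z]
    rw [← h]
    simp
  refine ⟨z.arg, Plane.ext ?_ ?_⟩
  · rw [unitVec_zero_apply, Complex.cos_arg (by rintro h0; simp [h0] at hz), hz, div_one]
  · rw [unitVec_one_apply, Complex.sin_arg, hz, div_one]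

/-- One-dimensional Borsuk–Ulam: `g` minus its antipode changes sign along half the unit circle, so
some antipodal pair has equal values. -/
lemma not_injective_of_continuous_unitVec {g : Plane → ℝ}
    (hg : ContinuousOn g (Metric.closedBall 0 1)) : ¬ Set.InjOn g (Metric.closedBall 0 1) := by
  intro hinj
  have hmem : ∀ θ, unitVec θ ∈ Metric.closedBall (0 : Plane) 1 := fun θ => by simp
  have hc : Continuous fun θ => g (unitVec θ) - g (unitVec (θ + Real.pi)) :=
    (hg.comp_continuous continuous_unitVec hmem).sub
      (hg.comp_continuous (continuous_unitVec.comp (continuous_add_const _)) fun θ => hmem _)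
  have h1 : ∃ θ, g (unitVec θ) - g (unitVec (θ + Real.pi)) = 0 := by
    have h2 := unitVec_add_pi Real.pi
    rw [← zero_add Real.pi, unitVec_add_pi, neg_neg, zero_add] at h2
    rcases le_total (g (unitVec 0) - g (unitVec (0 + Real.pi))) 0 with h | h
    · exact mem_range_of_exists_le_of_exists_ge hc ⟨0, h⟩ ⟨Real.pi, by
        rw [h2]; rw [zero_add] at h; linarith⟩
    · exact mem_range_of_exists_le_of_exists_ge hc ⟨Real.pi, by
        rw [h2]; rw [zero_add] at h; linarith⟩ ⟨0, h⟩
  obtain ⟨θ, hθ⟩ := h1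
  have h3 := hinj (hmem _) (hmem _) (sub_eq_zero.1 hθ)
  rw [unitVec_add_pi, eq_neg_iff_add_eq_zero, ← two_smul ℝ, smul_eq_zero] at h3
  have := norm_unitVec θ
  rw [h3.resolve_left two_ne_zero, norm_zero] at this
  exact zero_ne_one this

/-- A convex set without interior lies in a line, and a coordinate along that line would embed the
disk into `ℝ`. -/
lemma IsJordanDomain.interior_nonempty {D : Set Plane} (hD : IsJordanDomain D)
    (hconv : Convex ℝ D) : (interior D).Nonempty := by
  obtain ⟨e⟩ := hD
  rw [hconv.interior_nonempty_iff_affineSpan_eq_top]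
  by_contra hne
  have hDne : (affineSpan ℝ D : Set Plane).Nonempty :=
    ⟨_, subset_affineSpan ℝ D (e.symm ⟨0, by simp⟩).2⟩
  have hdir : (affineSpan ℝ D).direction ≠ ⊤ := fun h =>
    hne ((AffineSubspace.direction_eq_top_iff_of_nonempty hDne).1 h)
  obtain ⟨v, hv, hv0⟩ := Submodule.exists_mem_ne_zero_of_ne_bot
    (mt (Submodule.orthogonal_eq_bot_iff (K := (affineSpan ℝ D).direction)).1 hdir)
  have hperp : ∀ p ∈ D, ∀ q ∈ D, inner ℝ (p - q) v = 0 := fun p hp q hq =>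
    hv _ (AffineSubspace.vsub_mem_direction (subset_affineSpan ℝ D hp) (subset_affineSpan ℝ D hq))
  classical
  -- With `v` normal to the line, `rot v` points along it. The value `0` off the ball is irrelevant.
  let g : Plane → ℝ := fun x =>
    if hx : x ∈ Metric.closedBall (0 : Plane) 1 then inner ℝ (e.symm ⟨x, hx⟩ : Plane) (rot v) else 0
  have hgx : ∀ x : Metric.closedBall (0 : Plane) 1, g x = inner ℝ (e.symm x : Plane) (rot v) :=
    fun x => dif_pos x.2
  refine not_injective_of_continuous_unitVec (g := g) ?_ ?_
  · rw [continuousOn_iff_continuous_domRestrict]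
    have : Set.domRestrict (Metric.closedBall (0 : Plane) 1) g =
        fun x => inner ℝ (e.symm x : Plane) (rot v) := funext hgx
    rw [this]
    exact (continuous_subtype_val.comp e.symm.continuous).inner continuous_const
  · intro x hx y hy hxy
    have h1 := hgx ⟨x, hx⟩
    have h2 := hgx ⟨y, hy⟩
    have h3 := hperp _ (e.symm ⟨x, hx⟩).2 _ (e.symm ⟨y, hy⟩).2
    have h4 := norm_sq_smul_eq v ((e.symm ⟨x, hx⟩ : Plane) - (e.symm ⟨y, hy⟩ : Plane))
    rw [h3, inner_sub_left, ← h1, ← h2] at h4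
    simp only at h4
    rw [hxy, sub_self, zero_smul, zero_smul, add_zero] at h4
    have h5 := (smul_eq_zero.1 h4).resolve_left (by positivity)
    have h6 := e.symm.injective (Subtype.ext (sub_eq_zero.1 h5))
    exact congrArg Subtype.val h6

/-! ### Area of a disk with three caps. -/

/-- The part outside the disk of radius `r` of the convex hull of that disk and a point `A`. -/
def diskCap (r : ℝ) (A : Plane) : Set Plane :=
  convexHull ℝ (insert A (Metric.closedBall 0 r)) \ Metric.closedBall 0 r

lemma nullMeasurableSet_diskCap (r : ℝ) (A : Plane) : NullMeasurableSet (diskCap r A) :=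
  ((convex_convexHull ℝ _).nullMeasurableSet volume).diff
    Metric.isClosed_closedBall.measurableSet.nullMeasurableSet

/-- The reflection exchanging two points of equal norm preserves the disk and carries one cap to the
other. -/
lemma volume_diskCap_eq {r : ℝ} {A B : Plane} (h : ‖A‖ = ‖B‖) :
    volume (diskCap r A) = volume (diskCap r B) := by
  let φ : Plane ≃ₗᵢ[ℝ] Plane := (ℝ ∙ (A - B))ᗮ.reflection
  have hφ : φ A = B := Submodule.reflection_sub h
  have hball : φ '' Metric.closedBall 0 r = Metric.closedBall 0 r := by
    rw [φ.image_closedBall, map_zero]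
  have himg : φ '' diskCap r A = diskCap r B := by
    unfold diskCap
    rw [Set.image_sdiff φ.injective, hball]
    congr 1
    have := φ.toLinearEquiv.toLinearMap.image_convexHull (insert A (Metric.closedBall 0 r))
    simp only [LinearEquiv.coe_coe, LinearIsometryEquiv.coe_toLinearEquiv] at this
    rw [this, Set.image_insert_eq, hball, hφ]
  rw [← himg]
  have h1 : diskCap r A = φ ⁻¹' (φ '' diskCap r A) := (Set.preimage_image_eq _ φ.injective).symm
  conv_lhs => rw [h1]
  exact φ.measurePreserving.measure_preimage (himg ▸ nullMeasurableSet_diskCap r B)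

lemma diskCap_smul_subset {r c : ℝ} {A : Plane} (hr : 0 ≤ r) (h0 : 0 ≤ c) (h1 : c ≤ 1) :
    diskCap r (c • A) ⊆ diskCap r A := by
  refine Set.sdiff_subset_sdiff_left (convexHull_min (Set.insert_subset ?_ ?_)
    (convex_convexHull ℝ _))
  · refine (convex_convexHull ℝ _).smul_mem_of_zero_mem ?_ ?_ ⟨h0, h1⟩
    · exact subset_convexHull ℝ _ (Set.mem_insert_of_mem _ (by simpa using hr))
    · exact subset_convexHull ℝ _ (Set.mem_insert _ _)
  · exact (Set.subset_insert _ _).trans (subset_convexHull ℝ _)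

/-- Otherwise the half-plane `{p | inner ℝ p x ≤ r * ‖x‖}` contains `A` and the disk, hence `x`,
which forces `‖x‖ ≤ r`. -/
lemma lt_inner_of_mem_diskCap {r : ℝ} {A x : Plane} (hr : 0 ≤ r) (hx : x ∈ diskCap r A) :
    r * ‖x‖ < inner ℝ A x := by
  obtain ⟨h1, h2⟩ := hx
  have hx' : r < ‖x‖ := by simpa using h2
  by_contra! hA
  have hsub : convexHull ℝ (insert A (Metric.closedBall 0 r)) ⊆ {p | inner ℝ p x ≤ r * ‖x‖} := by
    refine convexHull_min (Set.insert_subset hA fun p hp => ?_) ?_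
    · have hp' : ‖p‖ ≤ r := by simpa using hp
      exact (real_inner_le_norm p x).trans (by gcongr)
    · exact convex_halfSpace_le ((innerSL ℝ).flip x).isLinear _
  have h3 : inner ℝ x x ≤ r * ‖x‖ := hsub h1
  rw [real_inner_self_eq_norm_sq] at h3
  nlinarith

/-- A common point `x` would put `A`, `B`, and so `b`, in the half-plane `r * ‖x‖ < inner ℝ p x`,
which misses the disk by Cauchy–Schwarz. -/
lemma disjoint_diskCap {r : ℝ} {A B b : Plane} (hr : 0 ≤ r) (hb : b ∈ segment ℝ A B)
    (hbr : ‖b‖ ≤ r) : Disjoint (diskCap r A) (diskCap r B) := by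
  rw [Set.disjoint_left]
  intro x hA hB
  have h1 := lt_inner_of_mem_diskCap hr hA
  have h2 := lt_inner_of_mem_diskCap hr hB
  have hc : Convex ℝ {p : Plane | r * ‖x‖ < inner ℝ p x} :=
    convex_halfSpace_gt ((innerSL ℝ).flip x).isLinear _
  have h3 : r * ‖x‖ < inner ℝ b x := hc.segment_subset h1 h2 hb
  have h4 := real_inner_le_norm b x
  have h5 : ‖b‖ * ‖x‖ ≤ r * ‖x‖ := by gcongr
  linarith

/-- The vertices of a regular hexagon. -/
noncomputable def hexVec : Fin 6 → Plane :=
  ![!₂[1, 0], !₂[1 / 2, √3 / 2], !₂[-(1 / 2), √3 / 2], !₂[-1, 0], !₂[-(1 / 2), -(√3 / 2)],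
    !₂[1 / 2, -(√3 / 2)]]

lemma norm_hexVec (k : Fin 6) : ‖hexVec k‖ = 1 := by
  have h3 : (√3) ^ 2 = 3 := Real.sq_sqrt (by norm_num)
  have h : ‖hexVec k‖ ^ 2 = 1 := by
    rw [Plane.norm_sq_eq]
    fin_cases k <;> simp [hexVec, div_pow] <;> norm_num
  exact (pow_eq_one_iff_of_nonneg (norm_nonneg _) two_ne_zero).1 h

/-- The triangles cut out of the hexagon with vertices at alternating distances `d` and `r`. -/
noncomputable def hexTriangle (r d : ℝ) (k : Fin 6) : Set Plane :=
  openTriangle ((![d, r, d, r, d, r] : Fin 6 → ℝ) k • hexVec k)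
    ((![r, d, r, d, r, d] : Fin 6 → ℝ) k • hexVec (k + 1))

lemma volume_hexTriangle {r d : ℝ} (hr : 0 < r) (hd : 0 < d) (k : Fin 6) :
    volume (hexTriangle r d k) = ENNReal.ofReal (√3 / 4 * r * d) := by
  rw [hexTriangle, volume_openTriangle]
  congr 1
  have h : cross ((![d, r, d, r, d, r] : Fin 6 → ℝ) k • hexVec k)
      ((![r, d, r, d, r, d] : Fin 6 → ℝ) k • hexVec (k + 1)) = √3 / 2 * r * d := by
    fin_cases k <;> simp [cross, hexVec, -mul_eq_mul_right_iff] <;> ring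
  rw [h, abs_of_pos (by positivity)]
  ring

/-- The signs of `cross (hexVec j) ·`, `j = 0, 1, 2`, on the six sectors. -/
def hexSign : Fin 6 → Fin 3 → ℤ :=
  ![![1, -1, -1], ![1, 1, -1], ![1, 1, 1], ![-1, 1, 1], ![-1, -1, 1], ![-1, -1, -1]]

lemma hexSign_mul_cross_pos {r d : ℝ} (hr : 0 < r) (hd : 0 < d) (k : Fin 6) (j : Fin 3) {p : Plane}
    (hp : p ∈ hexTriangle r d k) :
    0 < (hexSign k j : ℝ) * cross (hexVec (j.castLE (by norm_num))) p := by
  obtain ⟨a, b, ha, hb, -, rfl⟩ := hp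
  have h1 : 0 < a * d * √3 := by positivity
  have h2 : 0 < b * d * √3 := by positivity
  have h3 : 0 < a * r * √3 := by positivity
  have h4 : 0 < b * r * √3 := by positivity
  fin_cases k <;> fin_cases j <;> simp [cross, hexVec, hexSign] <;> linarith

/-- The three lines through opposite vertices separate any two of the six sectors. -/
lemma disjoint_hexTriangle {r d : ℝ} (hr : 0 < r) (hd : 0 < d) {k l : Fin 6} (hkl : k ≠ l) :
    Disjoint (hexTriangle r d k) (hexTriangle r d l) := by
  rw [Set.disjoint_left]
  intro p hk hl
  have h : ∀ k l : Fin 6, k ≠ l → ∃ j, hexSign k j = -hexSign l j := by decide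
  obtain ⟨j, hj⟩ := h k l hkl
  have h1 := hexSign_mul_cross_pos hr hd k j hk
  have h2 := hexSign_mul_cross_pos hr hd l j hl
  rw [hj] at h1
  push_cast at h1
  linarith

lemma isOpen_openTriangle_of_cross_ne_zero {x y : Plane} (h : cross x y ≠ 0) :
    IsOpen (openTriangle x y) := by
  have e : openTriangle x y =
      {p | 0 < cross p y / cross x y ∧ 0 < cross x p / cross x y ∧
        cross p y / cross x y + cross x p / cross x y < 1} := by
    ext p
    constructor
    · rintro ⟨a, b, ha, hb, hab, rfl⟩
      have h1 : cross (a • x + b • y) y / cross x y = a := by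
        rw [div_eq_iff h]; simp [cross]; ring
      have h2 : cross x (a • x + b • y) / cross x y = b := by
        rw [div_eq_iff h]; simp [cross]; ring
      simp only [Set.mem_ofPred_eq, h1, h2]
      exact ⟨ha, hb, hab⟩
    · rintro ⟨ha, hb, hab⟩
      refine ⟨_, _, ha, hb, hab, ?_⟩
      apply Plane.ext <;> simp only [PiLp.add_apply, PiLp.smul_apply, smul_eq_mul] <;>
      · field_simp
        simp only [cross]
        ring
  rw [e]
  have c1 : Continuous fun p => cross p y / cross x y := by unfold cross; fun_prop
  have c2 : Continuous fun p => cross x p / cross x y := by unfold cross; fun_prop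
  exact (isOpen_lt continuous_const c1).inter ((isOpen_lt continuous_const c2).inter
    (isOpen_lt (c1.add c2) continuous_const))

lemma isOpen_hexTriangle {r d : ℝ} (hr : 0 < r) (hd : 0 < d) (k : Fin 6) :
    IsOpen (hexTriangle r d k) := by
  refine isOpen_openTriangle_of_cross_ne_zero fun h => ?_
  have h1 := volume_hexTriangle hr hd k
  rw [hexTriangle, volume_openTriangle, h] at h1
  have h2 : 0 < √3 / 4 * r * d := by positivity
  simp at h1
  linarith

lemma hexTriangle_subset {r d : ℝ} (hr : 0 < r) (k : Fin 6) :
    hexTriangle r d k ⊆ Metric.closedBall 0 r ∪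
      ⋃ j : Fin 3, diskCap r (d • hexVec ((![0, 2, 4] : Fin 3 → Fin 6) j)) := by
  have key : ∀ (j : Fin 3) (x y : Plane),
      x ∈ insert (d • hexVec ((![0, 2, 4] : Fin 3 → Fin 6) j)) (Metric.closedBall 0 r) →
      y ∈ insert (d • hexVec ((![0, 2, 4] : Fin 3 → Fin 6) j)) (Metric.closedBall 0 r) →
      openTriangle x y ⊆ Metric.closedBall 0 r ∪
        ⋃ j : Fin 3, diskCap r (d • hexVec ((![0, 2, 4] : Fin 3 → Fin 6) j)) := by
    rintro j x y hx hy p ⟨a, b, ha, hb, hab, rfl⟩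
    by_cases hp : a • x + b • y ∈ Metric.closedBall (0 : Plane) r
    · exact Or.inl hp
    · refine Or.inr (Set.mem_iUnion.2 ⟨j, ?_, hp⟩)
      have h0 : (0 : Plane) ∈ convexHull ℝ
          (insert (d • hexVec ((![0, 2, 4] : Fin 3 → Fin 6) j)) (Metric.closedBall 0 r)) :=
        subset_convexHull ℝ _ (Set.mem_insert_of_mem _ (by simpa using hr.le))
      -- The point is a convex combination of `x` and `y`, shrunk by `a + b < 1` towards `0`, which
      -- lies in the disk.
      have h1 := (convex_convexHull ℝ _) (subset_convexHull ℝ _ hx) (subset_convexHull ℝ _ hy)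
        (show 0 ≤ a / (a + b) by positivity) (show 0 ≤ b / (a + b) by positivity)
        (by field_simp)
      have h2 := (convex_convexHull ℝ _).smul_mem_of_zero_mem h0 h1
        (t := a + b) ⟨by positivity, hab.le⟩
      convert h2 using 1
      rw [smul_add, smul_smul, smul_smul, mul_div_cancel₀ _ (by positivity),
        mul_div_cancel₀ _ (by positivity)]
  have hball : ∀ k, r • hexVec k ∈ Metric.closedBall (0 : Plane) r := fun k => by
    simp [norm_smul, norm_hexVec, abs_of_pos hr]
  fin_cases k
  · exact key 0 _ _ (Or.inl rfl) (Or.inr (hball _))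
  · exact key 1 _ _ (Or.inr (hball _)) (Or.inl rfl)
  · exact key 1 _ _ (Or.inl rfl) (Or.inr (hball _))
  · exact key 2 _ _ (Or.inr (hball _)) (Or.inl rfl)
  · exact key 2 _ _ (Or.inl rfl) (Or.inr (hball _))
  · exact key 0 _ _ (Or.inr (hball _)) (Or.inl rfl)

/-- Three congruent caps in directions 120° apart, with the disk, cover a hexagon with vertices
alternately at distances `‖A‖` and `r`; subadditivity of area suffices. -/
lemma hexagon_area_le {r : ℝ} {A : Plane} (hr : 0 < r) (hA : A ≠ 0) :
    ENNReal.ofReal (3 * √3 / 2 * r * ‖A‖) ≤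
      volume (Metric.closedBall (0 : Plane) r) + 3 * volume (diskCap r A) := by
  have hd : 0 < ‖A‖ := norm_pos_iff.2 hA
  set d := ‖A‖ with hdef
  have h1 : volume (⋃ k, hexTriangle r d k) = ENNReal.ofReal (3 * √3 / 2 * r * d) := by
    rw [measure_iUnion (fun k l hkl => disjoint_hexTriangle hr hd hkl)
      (fun k => (isOpen_hexTriangle hr hd k).measurableSet), tsum_fintype]
    simp only [volume_hexTriangle hr hd, Finset.sum_const, Finset.card_univ, Fintype.card_fin,
      nsmul_eq_mul]
    rw [← ENNReal.ofReal_natCast, ← ENNReal.ofReal_mul (by positivity)]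
    congr 1
    push_cast
    ring
  rw [← h1]
  refine (measure_mono (Set.iUnion_subset fun k => hexTriangle_subset hr k)).trans
    ((measure_union_le _ _).trans ?_)
  gcongr
  refine (measure_iUnion_le _).trans ?_
  rw [tsum_fintype]
  have h2 : ∀ j : Fin 3, volume (diskCap r (d • hexVec ((![0, 2, 4] : Fin 3 → Fin 6) j))) =
      volume (diskCap r A) := fun j => volume_diskCap_eq (by
    rw [norm_smul, norm_hexVec, mul_one, Real.norm_of_nonneg hd.le])
  simp [h2]

/-- Pulling each `A i` back to distance exactly `d` shrinks its cap, keeps the caps disjoint and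
makes them congruent. Their area then does not depend on their directions, and the regular position
of the hexagon bounds it. -/
lemma le_volume_of_disk_of_points {D : Set Plane} (hD : Convex ℝ D) {r d : ℝ} (hr : 0 < r)
    (hd : 0 < d) (hball : Metric.closedBall 0 r ⊆ D) (A : Fin 3 → Plane) (hA : ∀ i, A i ∈ D)
    (hdA : ∀ i, d ≤ ‖A i‖) (hseg : ∀ i j, i ≠ j → ∃ b ∈ segment ℝ (A i) (A j), ‖b‖ ≤ r) :
    ENNReal.ofReal (3 * √3 / 2 * r * d) ≤ volume D := by
  let B : Fin 3 → Plane := fun i => (d / ‖A i‖) • A i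
  have hpos : ∀ i, 0 < ‖A i‖ := fun i => hd.trans_le (hdA i)
  have hB : ∀ i, ‖B i‖ = d := fun i => by
    simp only [B]
    rw [norm_smul, Real.norm_of_nonneg (div_pos hd (hpos i)).le, div_mul_cancel₀ _ (hpos i).ne']
  have hBA : ∀ i, diskCap r (B i) ⊆ diskCap r (A i) := fun i =>
    diskCap_smul_subset hr.le (div_pos hd (hpos i)).le ((div_le_one (hpos i)).2 (hdA i))
  have hB0 : B 0 ≠ 0 := by rw [← norm_pos_iff, hB]; exact hd
  have h1 := hexagon_area_le hr hB0
  rw [hB] at h1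
  refine h1.trans ?_
  have h2 : volume (⋃ i, diskCap r (B i)) = 3 * volume (diskCap r (B 0)) := by
    rw [measure_iUnion₀ (fun i j hij => ?_) (fun i => nullMeasurableSet_diskCap r _), tsum_fintype]
    · have : ∀ i, volume (diskCap r (B i)) = volume (diskCap r (B 0)) := fun i =>
        volume_diskCap_eq (by rw [hB, hB])
      simp [this]
    · obtain ⟨b, hb, hbr⟩ := hseg i j hij
      exact ((disjoint_diskCap hr.le hb hbr).mono (hBA i) (hBA j)).aedisjoint
  rw [← h2, ← measure_union₀' Metric.isClosed_closedBall.measurableSet.nullMeasurableSet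
    (Disjoint.aedisjoint ?_)]
  · refine measure_mono (Set.union_subset hball (Set.iUnion_subset fun i => ?_))
    exact (hBA i).trans (Set.sdiff_subset.trans
      (convexHull_min (Set.insert_subset (hA i) hball) hD))
  · exact Set.disjoint_iUnion_right.2 fun i => Set.disjoint_sdiff_right

/-! ### Pál's inequality from contact data. -/

/-- The cones spanned by pairs of the `z i` cover the plane: from any expansion of `u` one subtracts
the multiple of the relation `c` that makes the smallest ratio vanish. -/
lemma exists_nonneg_combination {z : Fin 3 → Plane} (hz : AffineIndependent ℝ z) {c : Fin 3 → ℝ}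
    (hc : ∀ i, 0 < c i) (hcz : ∑ i, c i • z i = 0) (u : Plane) :
    ∃ a : Fin 3 → ℝ, (∀ i, 0 ≤ a i) ∧ (∃ m, a m = 0) ∧ u = ∑ i, a i • z i := by
  let b : AffineBasis (Fin 3) ℝ Plane :=
    ⟨z, hz, by rw [hz.affineSpan_eq_top_iff_card_eq_finrank_add_one]; simp⟩
  have hu : ∑ i, b.coord i u • z i = u := b.linear_combination_coord_eq_self u
  obtain ⟨m, -, hm⟩ := Finset.exists_min_image Finset.univ (fun i => b.coord i u / c i)
    Finset.univ_nonempty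
  refine ⟨fun i => b.coord i u - b.coord m u / c m * c i, fun i => ?_, ⟨m, ?_⟩, ?_⟩
  · have := hm i (Finset.mem_univ i)
    rw [le_div_iff₀ (hc i)] at this
    linarith
  · simp only [div_mul_cancel₀ _ (hc m).ne', sub_self]
  · simp only [sub_smul, Finset.sum_sub_distrib, mul_smul]
    rw [← Finset.smul_sum, hcz, smul_zero, sub_zero, hu]

/-- With one coefficient zero, the sum is `a p • z p + a l • z l`; its product with `A` is at most
`r * (a l - a p)`, and the triangle inequality bounds `a l - a p` by the norm of the sum. -/
lemma inner_le_of_sum_eq {z : Fin 3 → Plane} (hz : ∀ i, ‖z i‖ = 1) {a : Fin 3 → ℝ}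
    (ha : ∀ i, 0 ≤ a i) {p m : Fin 3} (hpm : p ≠ m) (hm : a m = 0) {A : Plane} {r : ℝ} (hr : 0 ≤ r)
    (hAz : ∀ j, inner ℝ A (z j) ≤ r) (hA : inner ℝ A (z p) ≤ -r) :
    inner ℝ A (∑ i, a i • z i) ≤ r * ‖∑ i, a i • z i‖ := by
  have key : ∀ l, inner ℝ A (a p • z p + a l • z l) ≤ r * ‖a p • z p + a l • z l‖ := by
    intro l
    have h1 : a l ≤ ‖a p • z p + a l • z l‖ + a p := by
      have h2 := norm_sub_le (a p • z p + a l • z l) (a p • z p)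
      rwa [add_sub_cancel_left, norm_smul, norm_smul, hz, hz, Real.norm_of_nonneg (ha l),
        Real.norm_of_nonneg (ha p), mul_one, mul_one] at h2
    rw [inner_add_right, real_inner_smul_right, real_inner_smul_right]
    have h3 := mul_le_mul_of_nonneg_left hA (ha p)
    have h4 := mul_le_mul_of_nonneg_left (hAz l) (ha l)
    have h5 := mul_le_mul_of_nonneg_left h1 hr
    linarith
  obtain ⟨l, hl⟩ : ∃ l, ∑ i, a i • z i = a p • z p + a l • z l := by
    rw [Fin.sum_univ_three]
    fin_cases m <;> fin_cases p <;>
      simp only [Fin.zero_eta, Fin.mk_one, Fin.reduceFinMk, ne_eq, not_true_eq_false] at hpm hm ⊢ <;>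
      rw [hm, zero_smul]
    · exact ⟨2, by abel⟩
    · exact ⟨1, by abel⟩
    · exact ⟨2, by abel⟩
    · exact ⟨0, by abel⟩
    · exact ⟨1, by abel⟩
    · exact ⟨0, by abel⟩
  rw [hl]
  exact key l

/-- If the segment misses the disk, its point `u` nearest to `0` satisfies `inner ℝ p u > r * ‖u‖`
all along it. But `u` lies in a cone omitting one index `m`, and whichever of `i`, `j` differs from
`m` violates this by `inner_le_of_sum_eq`. -/
lemma exists_mem_segment_norm_le {z : Fin 3 → Plane} (hz : AffineIndependent ℝ z)
    (hz1 : ∀ i, ‖z i‖ = 1) {c : Fin 3 → ℝ} (hc : ∀ i, 0 < c i) (hcz : ∑ i, c i • z i = 0)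
    {r : ℝ} (hr : 0 ≤ r) {A : Fin 3 → Plane} (hAz : ∀ i j, inner ℝ (A i) (z j) ≤ r)
    (hA : ∀ i, inner ℝ (A i) (z i) ≤ -r) {i j : Fin 3} (hij : i ≠ j) :
    ∃ b ∈ segment ℝ (A i) (A j), ‖b‖ ≤ r := by
  by_contra! hcon
  have hne : (segment ℝ (A i) (A j)).Nonempty := ⟨_, left_mem_segment ℝ _ _⟩
  have hcomp : IsComplete (segment ℝ (A i) (A j)) := by
    rw [← convexHull_pair]
    exact ((Set.toFinite _).isCompact_convexHull ℝ).isComplete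
  obtain ⟨u, hu, hmin⟩ := exists_norm_eq_iInf_of_complete_convex hne hcomp
    (convex_segment _ _) 0
  rw [norm_eq_iInf_iff_real_inner_le_zero (convex_segment _ _) hu] at hmin
  have hlt : ∀ p ∈ segment ℝ (A i) (A j), r * ‖u‖ < inner ℝ p u := by
    intro p hp
    have h1 := hmin p hp
    rw [zero_sub, inner_neg_left, inner_sub_right, real_inner_self_eq_norm_sq,
      real_inner_comm] at h1
    have h2 := hcon u hu
    nlinarith
  obtain ⟨a, ha, ⟨m, hm⟩, hua⟩ := exists_nonneg_combination hz hc hcz u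
  have hfin : ∀ p, p ≠ m → inner ℝ (A p) u ≤ r * ‖u‖ := fun p hp => by
    rw [hua]
    exact inner_le_of_sum_eq hz1 ha hp hm hr (hAz p) (hA p)
  by_cases him : i = m
  · exact (hlt _ (right_mem_segment ℝ _ _)).not_ge (hfin j fun h => hij (him.trans h.symm))
  · exact (hlt _ (left_mem_segment ℝ _ _)).not_ge (hfin i him)

/-- Pál's inequality for a convex set with an inscribed disk centred at the origin, given the
normals `z i` at points of contact. -/
lemma pal_inequality_of_contact {D : Set Plane} (hD : Convex ℝ D) {r w : ℝ} (hr : 0 < r)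
    (hw : 0 ≤ w) (hball : Metric.closedBall 0 r ⊆ D) {ι : Type} [Fintype ι] {z : ι → Plane}
    (hz : AffineIndependent ℝ z) (hz1 : ∀ i, ‖z i‖ = 1) {c : ι → ℝ} (hc : ∀ i, 0 < c i)
    (hc1 : ∑ i, c i = 1) (hcz : ∑ i, c i • z i = 0) (hDz : ∀ p ∈ D, ∀ i, inner ℝ p (z i) ≤ r)
    (hwidth : ∀ i, ∃ p ∈ D, w - r ≤ -inner ℝ p (z i)) :
    ENNReal.ofReal (w ^ 2 / √3) ≤ volume D := by
  have h3 : (√3) ^ 2 = 3 := Real.sq_sqrt (by norm_num)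
  have hs3 : 0 < √3 := by positivity
  choose A hAD hA using hwidth
  have hcard : Fintype.card ι ≤ 3 := by
    have h1 := hz.card_le_finrank_succ
    have h2 := Submodule.finrank_le (vectorSpan ℝ (Set.range z))
    rw [finrank_euclideanSpace_fin] at h2
    omega
  -- Pairing `A i` with the relation `∑ c j • z j = 0` gives `c i * (w - r) ≤ (1 - c i) * r`. Summed
  -- over at most three indices this yields `w ≤ 3 * r`.
  have hcw : ∀ i, c i * w ≤ r := by
    intro i
    have h1 : ∑ j, c j * inner ℝ (A i) (z j) = 0 := by
      have h2 : inner ℝ (A i) (∑ j, c j • z j) = 0 := by rw [hcz, inner_zero_right]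
      rw [inner_sum] at h2
      simpa only [real_inner_smul_right] using h2
    classical
    rw [← Finset.add_sum_erase _ _ (Finset.mem_univ i)] at h1 hc1
    have h2 : ∑ j ∈ Finset.univ.erase i, c j * inner ℝ (A i) (z j) ≤
        ∑ j ∈ Finset.univ.erase i, c j * r :=
      Finset.sum_le_sum fun j _ => mul_le_mul_of_nonneg_left (hDz _ (hAD i) j) (hc j).le
    rw [← Finset.sum_mul] at h2
    have h4 : ∑ j ∈ Finset.univ.erase i, c j = 1 - c i := by linarith
    rw [h4] at h2
    have h5 := mul_le_mul_of_nonneg_left (hA i) (hc i).le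
    linarith
  have hwcard : w ≤ Fintype.card ι * r := by
    have h1 : ∑ i, c i * w ≤ ∑ _i : ι, r := Finset.sum_le_sum fun i _ => hcw i
    rw [← Finset.sum_mul, hc1, one_mul] at h1
    simpa using h1
  -- For `w ≤ 2 * r` the disk suffices, as `π * √3 ≥ 4`; for `w > 2 * r` the bound `w ≤ card * r`
  -- leaves exactly three normals.
  rcases le_or_gt w (2 * r) with hw2 | hw2
  · refine le_trans ?_ (measure_mono hball)
    rw [EuclideanSpace.volume_closedBall_fin_two, ← ENNReal.ofReal_pow hr.le,
      ← ENNReal.ofReal_mul (by positivity)]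
    refine ENNReal.ofReal_le_ofReal ?_
    rw [div_le_iff₀ hs3]
    have h4 : 1.7 ≤ √3 := Real.le_sqrt_of_sq_le (by norm_num)
    have h5 := Real.pi_gt_three
    have h6 : 4 ≤ Real.pi * √3 := by nlinarith
    nlinarith [sq_nonneg r, mul_nonneg hw (sub_nonneg.2 hw2)]
  · have hcard3 : Fintype.card ι = 3 := by
      by_contra hne
      have h1 : Fintype.card ι ≤ 2 := by omega
      have h2 : (Fintype.card ι : ℝ) ≤ 2 := by exact_mod_cast h1
      nlinarith
    rw [hcard3] at hwcard
    push_cast at hwcard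
    let e := Fintype.equivFinOfCardEq hcard3
    have hAz : ∀ i, inner ℝ (A i) (z i) ≤ -r := fun i => by linarith [hA i]
    have hmain := le_volume_of_disk_of_points hD hr (d := w - r) (by linarith) hball
      (A ∘ e.symm) (fun i => hAD _) (fun i => ?_) (fun i j hij =>
        exists_mem_segment_norm_le (z := z ∘ e.symm) (c := c ∘ e.symm)
          (hz.comp_embedding e.symm.toEmbedding) (fun i => hz1 _) (fun i => hc _)
          ((Equiv.sum_comp e.symm fun i => c i • z i).trans hcz) hr.le
          (fun i j => hDz _ (hAD _) _) (fun i => hAz _) hij)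
    · refine le_trans (ENNReal.ofReal_le_ofReal ?_) hmain
      rw [div_le_iff₀ hs3]
      -- The claim `9 * r * (w - r) ≥ 2 * w ^ 2` factors as `(3 * r - w) * (2 * w - 3 * r) ≥ 0`.
      nlinarith [mul_nonneg (sub_nonneg.2 hwcard) (show 0 ≤ 2 * w - 3 * r by linarith)]
    · have h1 := hA (e.symm i)
      have h2 := norm_inner_le_norm (𝕜 := ℝ) (A (e.symm i)) (z (e.symm i))
      rw [hz1, mul_one, Real.norm_eq_abs] at h2
      exact (h1.trans (neg_le_abs _)).trans h2

/-! ### Support functions and the largest inscribed disk. -/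

lemma isCompact_convexHull_of_finiteDimensional {E : Type*} [NormedAddCommGroup E]
    [NormedSpace ℝ E] [FiniteDimensional ℝ E] {s : Set E} (hs : IsCompact s) :
    IsCompact (convexHull ℝ s) := by
  -- Carathéodory: at most `finrank + 1` points are needed, whence the range up to `finrank + 2`;
  -- each piece is a continuous image of a compact set.
  have e : convexHull ℝ s = ⋃ k ∈ Finset.range (Module.finrank ℝ E + 2),
      (fun p : (Fin k → ℝ) × (Fin k → E) => ∑ i, p.1 i • p.2 i) ''
        (stdSimplex ℝ (Fin k) ×ˢ Set.univ.pi fun _ => s) := by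
    ext x
    simp only [Set.mem_iUnion, Finset.mem_range, exists_prop]
    constructor
    · intro hx
      obtain ⟨ι, _, z, w, hz, hind, hw, hw1, hx⟩ := eq_pos_convex_span_of_mem_convexHull hx
      have h1 := hind.card_le_finrank_succ
      have h2 := Submodule.finrank_le (vectorSpan ℝ (Set.range z))
      let e := Fintype.equivFin ι
      refine ⟨Fintype.card ι, by omega, ⟨w ∘ e.symm, z ∘ e.symm⟩, ⟨⟨fun i => (hw _).le, ?_⟩, ?_⟩, ?_⟩
      · exact (Equiv.sum_comp e.symm w).trans hw1
      · exact fun i _ => hz ⟨_, rfl⟩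
      · exact (Equiv.sum_comp e.symm fun i => w i • z i).trans hx
    · rintro ⟨k, -, ⟨w, z⟩, ⟨⟨hw, hw1⟩, hz⟩, rfl⟩
      exact (convex_convexHull ℝ s).sum_mem (fun i _ => hw i) hw1
        fun i _ => subset_convexHull ℝ s (hz i trivial)
  rw [e]
  refine (Finset.range _).isCompact_biUnion fun k _ => IsCompact.image ?_ (by fun_prop)
  exact (isCompact_stdSimplex ℝ (Fin k)).prod (isCompact_univ_pi fun _ => hs)

/-- The support function of a plane set. -/
noncomputable def supportFn (D : Set Plane) (n : Plane) : ℝ :=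
  sSup ((fun p => inner ℝ n p) '' D)

section supportFn

variable {D : Set Plane}

lemma inner_le_supportFn (hc : IsCompact D) {p : Plane} (hp : p ∈ D) (n : Plane) :
    inner ℝ p n ≤ supportFn D n := by
  rw [real_inner_comm]
  exact le_csSup (hc.image (by fun_prop)).bddAbove ⟨p, hp, rfl⟩

lemma exists_inner_eq_supportFn (hc : IsCompact D) (hne : D.Nonempty) (n : Plane) :
    ∃ p ∈ D, inner ℝ p n = supportFn D n := by
  have hcont : ContinuousOn (fun p : Plane => inner ℝ n p) D :=
    (continuous_const.inner continuous_id).continuousOn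
  obtain ⟨p, hp, h⟩ := hc.exists_sSup_image_eq hne hcont
  exact ⟨p, hp, by rw [real_inner_comm, supportFn, h]⟩

lemma continuous_supportFn (hc : IsCompact D) : Continuous (supportFn D) :=
  hc.continuous_sSup (f := fun n p => inner ℝ n p) (continuous_fst.inner continuous_snd)

/-- A point outside is strictly separated from `D`; the normalized separating normal violates the
hypothesis. -/
lemma mem_of_forall_inner_le_supportFn (hD : Convex ℝ D) (hc : IsCompact D) (hne : D.Nonempty)
    {p : Plane} (hp : ∀ n, ‖n‖ = 1 → inner ℝ p n ≤ supportFn D n) : p ∈ D := by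
  by_contra hpD
  obtain ⟨f, u, hfp, hfD⟩ := geometric_hahn_banach_point_closed hD hc.isClosed hpD
  obtain ⟨v, rfl⟩ := (InnerProductSpace.toDual ℝ Plane).surjective f
  simp only [InnerProductSpace.toDual_apply_apply] at hfp hfD
  have hv : v ≠ 0 := by
    rintro rfl
    obtain ⟨q, hq⟩ := hne
    have := hfD q hq
    simp only [inner_zero_left] at this hfp
    linarith
  have hv' : 0 < ‖v‖ := norm_pos_iff.2 hv
  obtain ⟨q, hq, hqe⟩ := exists_inner_eq_supportFn hc hne (-(‖v‖⁻¹ • v))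
  have h1 := hp (-(‖v‖⁻¹ • v)) (by
    rw [norm_neg, norm_smul, norm_inv, norm_norm, inv_mul_cancel₀ hv'.ne'])
  rw [← hqe, inner_neg_right, inner_neg_right, real_inner_smul_right, real_inner_smul_right,
    neg_le_neg_iff, mul_le_mul_iff_right₀ (by positivity), real_inner_comm, real_inner_comm v p] at h1
  linarith [hfD q hq]

/-- Existence of a maximal inscribed disk, whose points of contact have normals with `0` in their
convex hull. -/
lemma exists_inscribed_disk (hD : Convex ℝ D) (hc : IsCompact D) (hi : (interior D).Nonempty) :
    ∃ (O : Plane) (r : ℝ), 0 < r ∧ Metric.closedBall O r ⊆ D ∧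
      (0 : Plane) ∈ convexHull ℝ {n : Plane | ‖n‖ = 1 ∧ supportFn D n = inner ℝ O n + r} := by
  have hne : D.Nonempty := hi.mono interior_subset
  have hscont := continuous_supportFn hc
  let K : Set (Plane × ℝ) :=
    {x | x.1 ∈ D ∧ 0 ≤ x.2 ∧ ∀ n, ‖n‖ = 1 → inner ℝ x.1 n + x.2 ≤ supportFn D n}
  have hKc : IsCompact K := by
    have hsub : K ⊆ D ×ˢ Set.Icc 0 (supportFn D (unitVec 0) + supportFn D (-unitVec 0)) := by
      rintro ⟨x, ρ⟩ ⟨h1, h2, h3⟩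
      refine ⟨h1, h2, ?_⟩
      have h4 := h3 (unitVec 0) (norm_unitVec 0)
      have h5 := inner_le_supportFn hc h1 (-unitVec 0)
      rw [inner_neg_right] at h5
      simp only at h4 ⊢
      linarith
    refine (hc.prod isCompact_Icc).of_isClosed_subset ?_ hsub
    refine (hc.isClosed.preimage continuous_fst).inter
      ((isClosed_le continuous_const continuous_snd).inter ?_)
    have : {x : Plane × ℝ | ∀ n, ‖n‖ = 1 → inner ℝ x.1 n + x.2 ≤ supportFn D n} =
        ⋂ (n : Plane) (_ : ‖n‖ = 1), {x | inner ℝ x.1 n + x.2 ≤ supportFn D n} := by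
      ext x; simp
    change IsClosed {x : Plane × ℝ | ∀ n, ‖n‖ = 1 → inner ℝ x.1 n + x.2 ≤ supportFn D n}
    rw [this]
    exact isClosed_biInter fun n _ => isClosed_le (by fun_prop) continuous_const
  obtain ⟨p, hp⟩ := hi
  obtain ⟨ε, hε, hball⟩ := Metric.isOpen_iff.1 isOpen_interior p hp
  have hpK : (p, ε / 2) ∈ K := by
    refine ⟨interior_subset hp, by positivity, fun n hn => ?_⟩
    have h1 : p + (ε / 2) • n ∈ D := interior_subset (hball (by
      rw [Metric.mem_ball, dist_eq_norm, add_sub_cancel_left, norm_smul, hn,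
        Real.norm_of_nonneg (by positivity)]
      linarith))
    have h2 := inner_le_supportFn hc h1 n
    rwa [inner_add_left, real_inner_smul_left, real_inner_self_eq_norm_sq, hn, one_pow,
      mul_one] at h2
  obtain ⟨⟨O, r⟩, ⟨hO, -, hOr⟩, hmax⟩ := hKc.exists_isMaxOn ⟨_, hpK⟩ continuous_snd.continuousOn
  simp only at hO hOr
  have hmax' : ∀ x ρ, (x, ρ) ∈ K → ρ ≤ r := fun x ρ h => hmax h
  have hr : 0 < r := (half_pos hε).trans_le (hmax' _ _ hpK)
  refine ⟨O, r, hr, fun q hq => mem_of_forall_inner_le_supportFn hD hc hne fun n hn => ?_, ?_⟩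
  · have h1 := real_inner_le_norm (q - O) n
    rw [hn, mul_one, inner_sub_left] at h1
    rw [Metric.mem_closedBall, dist_eq_norm] at hq
    linarith [hOr n hn]
  let g : Plane → ℝ := fun n => supportFn D n - inner ℝ O n - r
  have hg : Continuous g := by fun_prop
  have hg0 : ∀ n, ‖n‖ = 1 → 0 ≤ g n := fun n hn => by simp only [g]; linarith [hOr n hn]
  -- Lifting each normal to the graph of its gap `g ≥ 0` lets a single separation argument handle
  -- contact and non-contact normals together.
  have h0 : (0 : Plane × ℝ) ∈ convexHull ℝ ((fun n => (n, g n)) '' Metric.sphere (0 : Plane) 1) := by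
    by_contra hcon
    have hS := isCompact_convexHull_of_finiteDimensional
      ((isCompact_sphere (0 : Plane) 1).image (continuous_id.prodMk hg))
    obtain ⟨f, δ, hδ, hf⟩ := geometric_hahn_banach_point_closed (convex_convexHull ℝ _)
      hS.isClosed hcon
    rw [map_zero] at hδ
    obtain ⟨v, hv⟩ := (InnerProductSpace.toDual ℝ Plane).surjective
      (f.comp (ContinuousLinearMap.inl ℝ Plane ℝ))
    have hfv : ∀ n t, f (n, t) = inner ℝ v n + t * f (0, 1) := by
      intro n t
      have h1 : ((n, t) : Plane × ℝ) = (n, 0) + t • (0, 1) := by simp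
      rw [h1, map_add, map_smul, smul_eq_mul]
      congr 1
      rw [← InnerProductSpace.toDual_apply_apply, hv]
      simp
    set μ := f (0, 1)
    have hlt : ∀ n, ‖n‖ = 1 → δ < inner ℝ v n + g n * μ := fun n hn => by
      rw [← hfv]
      exact hf _ (subset_convexHull ℝ _ ⟨n, by simpa using hn, rfl⟩)
    rcases le_or_gt μ 0 with hμ | hμ
    · obtain ⟨n, hn, hvn⟩ : ∃ n : Plane, ‖n‖ = 1 ∧ inner ℝ v n ≤ 0 := by
        rcases le_total (inner ℝ v (unitVec 0)) 0 with h | h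
        · exact ⟨_, norm_unitVec 0, h⟩
        · exact ⟨-unitVec 0, by rw [norm_neg, norm_unitVec], by rw [inner_neg_right]; linarith⟩
      have h1 := hlt n hn
      have h2 := mul_nonpos_of_nonneg_of_nonpos (hg0 n hn) hμ
      linarith
    -- Separation with `μ > 0` says that the disk with centre `O - μ⁻¹ • v` and larger radius `r + δ
    -- / μ` still fits, against maximality.
    · have hsep : ∀ n, ‖n‖ = 1 →
          inner ℝ (O - μ⁻¹ • v) n + (r + δ / μ) ≤ supportFn D n := by
        intro n hn
        have h1 := hlt n hn
        rw [inner_sub_left, real_inner_smul_left]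
        have h2 : δ / μ ≤ μ⁻¹ * inner ℝ v n + g n := by
          rw [div_le_iff₀ hμ]
          have h3 : (μ⁻¹ * inner ℝ v n + g n) * μ = inner ℝ v n + g n * μ := by
            field_simp
          rw [h3]
          exact h1.le
        simp only [g] at h2
        linarith
      have hpos : 0 < δ / μ := div_pos hδ hμ
      have := hmax' (O - μ⁻¹ • v) (r + δ / μ)
        ⟨mem_of_forall_inner_le_supportFn hD hc hne fun n hn => by linarith [hsep n hn],
          by positivity, hsep⟩
      linarith
  rw [mem_convexHull_iff_exists_fintype] at h0
  obtain ⟨ι, _, w, z, hw, hw1, hz, hsum⟩ := h0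
  choose n hn hnz using hz
  have hfst : ∑ i, w i • n i = 0 := by
    have := congrArg Prod.fst hsum
    rw [Prod.fst_sum] at this
    simp only [← hnz] at this
    exact this
  have hsnd : ∑ i, w i * g (n i) = 0 := by
    have := congrArg Prod.snd hsum
    rw [Prod.snd_sum] at this
    simp only [← hnz] at this
    exact this
  have hn1 : ∀ i, ‖n i‖ = 1 := fun i => by simpa using hn i
  -- The gaps are nonnegative with weighted sum zero, so every normal of nonzero weight is a contact
  -- normal.
  have hz0 := (Finset.sum_eq_zero_iff_of_nonneg
    fun i _ => mul_nonneg (hw i) (hg0 _ (hn1 i))).1 hsnd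
  classical
  rw [← hfst, ← Finset.sum_filter_of_ne (p := fun i => w i ≠ 0)
    (fun i _ h => fun h0 => h (by rw [h0, zero_smul]))]
  refine (convex_convexHull ℝ _).sum_mem (fun i _ => hw i) ?_ fun i hi =>
    subset_convexHull ℝ _ ⟨hn1 i, ?_⟩
  · rw [Finset.sum_filter_ne_zero, hw1]
  · have h1 := (mul_eq_zero.1 (hz0 i (Finset.mem_univ i))).resolve_left (Finset.mem_filter.1 hi).2
    simp only [g] at h1
    linarith

/-- **Pál's inequality**: a plane convex body of width at least `w` has area at least `w² / √3`. -/
theorem pal_inequality (hD : Convex ℝ D) (hc : IsCompact D) (hi : (interior D).Nonempty) {w : ℝ}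
    (hw0 : 0 ≤ w) (hw : ∀ n, ‖n‖ = 1 → w ≤ supportFn D n + supportFn D (-n)) :
    ENNReal.ofReal (w ^ 2 / √3) ≤ volume D := by
  obtain ⟨O, r, hr, hball, h0⟩ := exists_inscribed_disk hD hc hi
  obtain ⟨ι, _, z, c, hz, hind, hc0, hc1, hcz⟩ := eq_pos_convex_span_of_mem_convexHull h0
  have hz' : ∀ i, ‖z i‖ = 1 ∧ supportFn D (z i) = inner ℝ O (z i) + r := fun i => hz ⟨i, rfl⟩
  rw [← measure_preimage_add_right volume O D]
  refine pal_inequality_of_contact (hD.translate_preimage_left O) hr hw0 ?_ hind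
    (fun i => (hz' i).1) hc0 hc1 hcz (fun p hp i => ?_) fun i => ?_
  · intro p hp
    refine hball ?_
    simpa [dist_eq_norm] using hp
  · have h1 := inner_le_supportFn hc hp (z i)
    rw [(hz' i).2, inner_add_left] at h1
    linarith
  · obtain ⟨q, hq, hqe⟩ := exists_inner_eq_supportFn hc (hi.mono interior_subset) (-z i)
    refine ⟨q - O, by simpa using hq, ?_⟩
    have h1 := hw (z i) (hz' i).1
    rw [(hz' i).2, ← hqe, inner_neg_right] at h1
    rw [inner_sub_left]
    linarith

end supportFn

/-! ### Faces in almost every direction. -/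

lemma inner_rot_self (u : Plane) : inner ℝ u (rot u) = 0 := by
  rw [Plane.inner_eq, rot_zero_apply, rot_one_apply]; ring

lemma norm_rot (u : Plane) : ‖rot u‖ = ‖u‖ := by
  have h : ‖rot u‖ ^ 2 = ‖u‖ ^ 2 := by
    rw [Plane.norm_sq_eq, Plane.norm_sq_eq, rot_zero_apply, rot_one_apply]; ring
  exact (pow_left_inj₀ (norm_nonneg _) (norm_nonneg _) two_ne_zero).1 h

lemma norm_unitVec_sub_le (θ τ : ℝ) : ‖unitVec θ - unitVec τ‖ ≤ |θ - τ| := by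
  apply abs_le_of_sq_le_sq' _ (abs_nonneg _) |>.2
  rw [sq_abs, Plane.norm_sq_eq]
  have h1 := Real.one_sub_sq_div_two_le_cos (x := θ - τ)
  rw [Real.cos_sub] at h1
  simp only [PiLp.sub_apply, unitVec_zero_apply, unitVec_one_apply]
  nlinarith [Real.sin_sq_add_cos_sq θ, Real.sin_sq_add_cos_sq τ]

lemma hasDerivAt_inner_unitVec (p : Plane) (θ : ℝ) :
    HasDerivAt (fun τ => inner ℝ p (unitVec τ)) (inner ℝ p (rot (unitVec θ))) θ := by
  simp only [Plane.inner_eq, unitVec_zero_apply, unitVec_one_apply, rot_zero_apply, rot_one_apply]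
  exact ((Real.hasDerivAt_cos θ).const_mul _).add ((Real.hasDerivAt_sin θ).const_mul _)

section faces

variable {D : Set Plane}

lemma lipschitzWith_supportFn_unitVec (hc : IsCompact D) (hne : D.Nonempty) :
    ∃ C, LipschitzWith C fun θ => supportFn D (unitVec θ) := by
  obtain ⟨R, hR0, hR⟩ := hc.isBounded.exists_pos_norm_le
  refine ⟨⟨R, hR0.le⟩, LipschitzWith.of_le_add_mul _ fun θ τ => ?_⟩
  obtain ⟨p, hp, hpe⟩ := exists_inner_eq_supportFn hc hne (unitVec θ)
  have h1 := inner_le_supportFn hc hp (unitVec τ)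
  have h2 := real_inner_le_norm p (unitVec θ - unitVec τ)
  rw [inner_sub_right] at h2
  have h3 := norm_unitVec_sub_le θ τ
  have h4 := hR p hp
  have h5 : ‖p‖ * ‖unitVec θ - unitVec τ‖ ≤ R * |θ - τ| := by gcongr
  rw [Real.dist_eq]
  change _ ≤ _ + R * _
  linarith

/-- In almost every direction the face of a compact plane set is a single point. -/
lemma ae_subsingleton_face (hc : IsCompact D) (hne : D.Nonempty) :
    ∀ᵐ θ : ℝ, ∀ p ∈ D, ∀ q ∈ D, inner ℝ p (unitVec θ) = supportFn D (unitVec θ) →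
      inner ℝ q (unitVec θ) = supportFn D (unitVec θ) → p = q := by
  obtain ⟨C, hC⟩ := lipschitzWith_supportFn_unitVec hc hne
  filter_upwards [hC.ae_differentiableAt] with θ hθ p hp q hq hpe hqe
  have key : ∀ p ∈ D, inner ℝ p (unitVec θ) = supportFn D (unitVec θ) →
      deriv (fun θ => supportFn D (unitVec θ)) θ = inner ℝ p (rot (unitVec θ)) := by
    intro p hp hpe
    -- For `p` in the face, the support function exceeds `inner ℝ p` with equality at `θ`, so the
    -- derivatives agree. Thus the value and the derivative of the support function determine both
    -- coordinates of `p`.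
    have hmin : IsLocalMin (fun τ => supportFn D (unitVec τ) - inner ℝ p (unitVec τ)) θ :=
      Filter.Eventually.of_forall fun τ => by
        simp only [hpe, sub_self]
        exact sub_nonneg.2 (inner_le_supportFn hc hp _)
    exact sub_eq_zero.1
      (hmin.hasDerivAt_eq_zero (hθ.hasDerivAt.sub (hasDerivAt_inner_unitVec p θ)))
  have h1 : inner ℝ (p - q) (rot (unitVec θ)) = 0 := by
    rw [inner_sub_left, ← key p hp hpe, ← key q hq hqe, sub_self]
  have h2 : inner ℝ (p - q) (unitVec θ) = 0 := by rw [inner_sub_left, hpe, hqe, sub_self]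
  have h3 := norm_sq_smul_eq (unitVec θ) (p - q)
  rw [h1, h2, norm_unitVec] at h3
  simpa [sub_eq_zero] using h3

end faces

/-! ### Convex bodies as regions between two graphs. -/

lemma exists_upper_boundary {S : Set (ℝ × ℝ)} {a b : ℝ} (hab : a ≤ b) (hS : Convex ℝ S)
    (hc : IsCompact S) (hfst : ∀ z ∈ S, z.1 ∈ Set.Icc a b)
    (hex : ∀ x ∈ Set.Icc a b, ∃ y, (x, y) ∈ S) :
    ∃ U : ℝ → ℝ, ContinuousOn U (Set.Icc a b) ∧ (∀ x ∈ Set.Icc a b, (x, U x) ∈ S) ∧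
      ∀ z ∈ S, z.2 ≤ U z.1 := by
  have hmax : ∀ x, ∃ y, x ∈ Set.Icc a b → (x, y) ∈ S ∧ ∀ y', (x, y') ∈ S → y' ≤ y := by
    intro x
    by_cases hx : x ∈ Set.Icc a b
    · have hK : IsCompact (S ∩ {z | z.1 = x}) :=
        hc.inter_right (isClosed_eq continuous_fst continuous_const)
      obtain ⟨y, hy⟩ := hex x hx
      obtain ⟨⟨x', y₁⟩, ⟨h1, h2⟩, h3⟩ := hK.exists_isMaxOn ⟨(x, y), hy, rfl⟩
        continuous_snd.continuousOn
      obtain rfl : x' = x := h2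
      exact ⟨y₁, fun _ => ⟨h1, fun y' hy' => h3 ⟨hy', rfl⟩⟩⟩
    · exact ⟨0, fun h => absurd h hx⟩
  choose U hU using hmax
  have hUmem : ∀ x ∈ Set.Icc a b, (x, U x) ∈ S := fun x hx => (hU x hx).1
  have hUle : ∀ x y, (x, y) ∈ S → y ≤ U x := fun x y h => (hU x (hfst _ h)).2 y h
  refine ⟨U, fun x₀ hx₀ => ?_, hUmem, fun z hz => hUle _ _ hz⟩
  -- Concavity: the graph of `U` lies above its chords from `x₀`. For `c = x₀` the quotient is `0`
  -- and the bound is trivial.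
  have hchord : ∀ x ∈ Set.Icc a b, ∀ c ∈ Set.Icc a b, x ∈ segment ℝ x₀ c →
      U x₀ + (x - x₀) / (c - x₀) * (U c - U x₀) ≤ U x := by
    rintro x hx c hc' ⟨α, β, hα, hβ, hαβ, rfl⟩
    rcases eq_or_ne c x₀ with rfl | hne
    · simp only [sub_self, div_zero, zero_mul, add_zero]
      rw [← add_smul, hαβ, one_smul]
    · refine hUle _ _ ?_
      convert hS (hUmem x₀ hx₀) (hUmem c hc') hα hβ hαβ using 1
      ext
      · rfl
      · have hne' : c - x₀ ≠ 0 := sub_ne_zero.2 hne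
        have hα' : α = 1 - β := by linarith
        subst hα'
        simp only [smul_eq_mul, Prod.snd_add, Prod.smul_snd]
        field_simp
        ring
  -- Lower semicontinuity comes from the chords to `a` and `b`; upper semicontinuity because the
  -- part of `S` at height at least `y` has compact projection.
  refine tendsto_order.2 ⟨fun y hy => ?_, fun y hy => ?_⟩
  · have hl : ∀ c, Continuous fun x => U x₀ + (x - x₀) / (c - x₀) * (U c - U x₀) := fun c => by
      fun_prop
    have hlow := ((hl a).min (hl b)).continuousWithinAt (s := Set.Icc a b) (x := x₀)
    have hev := hlow.eventually_const_lt (u := y) (by simpa using hy)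
    filter_upwards [hev, self_mem_nhdsWithin] with x hx hxab
    rcases le_total x x₀ with h | h
    · refine hx.trans_le ((min_le_left _ _).trans (hchord x hxab a ⟨le_rfl, hab⟩ ?_))
      rw [segment_symm, segment_eq_Icc hx₀.1]
      exact ⟨hxab.1, h⟩
    · refine hx.trans_le ((min_le_right _ _).trans (hchord x hxab b ⟨hab, le_rfl⟩ ?_))
      rw [segment_eq_Icc hx₀.2]
      exact ⟨h, hxab.2⟩
  · have hK : IsCompact (Prod.fst '' (S ∩ {z | y ≤ z.2})) :=
      (hc.inter_right (isClosed_le continuous_const continuous_snd)).image continuous_fst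
    have hx : x₀ ∈ (Prod.fst '' (S ∩ {z | y ≤ z.2}))ᶜ := by
      rintro ⟨⟨x, y'⟩, ⟨h1, h2⟩, rfl⟩
      exact (hy.trans_le h2).not_ge (hUle _ _ h1)
    have hev : (Prod.fst '' (S ∩ {z | y ≤ z.2}))ᶜ ∈ nhdsWithin x₀ (Set.Icc a b) :=
      mem_nhdsWithin_of_mem_nhds (hK.isClosed.isOpen_compl.mem_nhds hx)
    filter_upwards [hev, self_mem_nhdsWithin] with x hx hxab
    by_contra! hcon
    exact hx ⟨(x, U x), ⟨hUmem x hxab, hcon⟩, rfl⟩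

lemma exists_lower_boundary {S : Set (ℝ × ℝ)} {a b : ℝ} (hab : a ≤ b) (hS : Convex ℝ S)
    (hc : IsCompact S) (hfst : ∀ z ∈ S, z.1 ∈ Set.Icc a b)
    (hex : ∀ x ∈ Set.Icc a b, ∃ y, (x, y) ∈ S) :
    ∃ L : ℝ → ℝ, ContinuousOn L (Set.Icc a b) ∧ (∀ x ∈ Set.Icc a b, (x, L x) ∈ S) ∧
      ∀ z ∈ S, L z.1 ≤ z.2 := by
  let φ : (ℝ × ℝ) →L[ℝ] ℝ × ℝ :=
    (ContinuousLinearMap.fst ℝ ℝ ℝ).prod (-ContinuousLinearMap.snd ℝ ℝ ℝ)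
  have hφ : ∀ x y, φ (x, y) = (x, -y) := fun x y => rfl
  obtain ⟨U, h1, h2, h3⟩ := exists_upper_boundary (S := φ '' S) hab (hS.linear_image φ.toLinearMap)
    (hc.image φ.continuous) (by rintro _ ⟨z, hz, rfl⟩; exact hfst z hz)
    (fun x hx => by
      obtain ⟨y, hy⟩ := hex x hx
      exact ⟨-y, (x, y), hy, rfl⟩)
  refine ⟨fun x => -U x, h1.neg, fun x hx => ?_, fun z hz => ?_⟩
  · obtain ⟨⟨x', y⟩, hz, he⟩ := h2 x hx
    rw [hφ, Prod.mk.injEq] at he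
    change (x, -U x) ∈ S
    rw [← he.2, neg_neg, ← he.1]
    exact hz
  · have := h3 _ ⟨z, hz, rfl⟩
    change -z.2 ≤ U z.1 at this
    linarith

lemma eVariationOn_affine_le (c w : Plane) :
    eVariationOn (fun s : unitInterval => c + (s : ℝ) • w) Set.univ ≤ ENNReal.ofReal ‖w‖ := by
  have h1 : LipschitzOnWith ‖w‖₊ (fun r : ℝ => c + r • w) Set.univ := by
    refine (LipschitzWith.of_dist_le_mul fun x y => ?_).lipschitzOnWith
    rw [dist_add_left, dist_eq_norm, ← sub_smul, norm_smul, coe_nnnorm, mul_comm, Real.dist_eq,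
      Real.norm_eq_abs]
  have h2 := h1.comp_eVariationOn_le (g := fun s : unitInterval => (s : ℝ)) (s := Set.univ)
    (Set.mapsTo_univ _ _)
  have h3 := MonotoneOn.eVariationOn_eq (f := fun s : unitInterval => (s : ℝ)) (s := Set.univ)
    (a := 0) (b := 1) (fun _ _ _ _ h => h) trivial trivial
  have h4 : (Set.univ ∩ Set.Icc 0 1 : Set unitInterval) = Set.univ :=
    Set.eq_univ_of_forall fun x => ⟨trivial, unitInterval.nonneg', unitInterval.le_one'⟩
  rw [h4] at h3
  rw [h3] at h2
  refine h2.trans (le_of_eq ?_)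
  simp
  rfl

/-- The point with coordinates `x`, `y` in the frame `u`, `rot u`. -/
def framePoint (u : Plane) (x y : ℝ) : Plane := x • u + y • rot u

section frame

variable {u : Plane}

lemma inner_framePoint (hu : ‖u‖ = 1) (x y : ℝ) : inner ℝ (framePoint u x y) u = x := by
  rw [framePoint, inner_add_left, real_inner_smul_left, real_inner_smul_left,
    real_inner_self_eq_norm_sq, hu, real_inner_comm, inner_rot_self]
  ring

lemma inner_framePoint_rot (hu : ‖u‖ = 1) (x y : ℝ) :
    inner ℝ (framePoint u x y) (rot u) = y := by
  rw [framePoint, inner_add_left, real_inner_smul_left, real_inner_smul_left,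
    real_inner_self_eq_norm_sq, norm_rot, hu, inner_rot_self]
  ring

lemma framePoint_inner (hu : ‖u‖ = 1) (p : Plane) :
    framePoint u (inner ℝ p u) (inner ℝ p (rot u)) = p := by
  have := norm_sq_smul_eq u p
  rw [hu, one_pow, one_smul] at this
  exact this.symm

lemma continuous_framePoint (u : Plane) : Continuous fun z : ℝ × ℝ => framePoint u z.1 z.2 := by
  unfold framePoint
  fun_prop

lemma framePoint_combo (u : Plane) (α β x y x' y' : ℝ) :
    α • framePoint u x y + β • framePoint u x' y' =
      framePoint u (α * x + β * x') (α * y + β * y') := by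
  unfold framePoint
  module

/-- `L` and `U` describe the convex body `D` as the region between two graphs over `[a, b]` in the
frame `u`, `rot u`. -/
structure IsRegionBetween (D : Set Plane) (u : Plane) (a b : ℝ) (L U : ℝ → ℝ) : Prop where
  norm_eq : ‖u‖ = 1
  continuousOn_lower : ContinuousOn L (Set.Icc a b)
  continuousOn_upper : ContinuousOn U (Set.Icc a b)
  lower_mem : ∀ x ∈ Set.Icc a b, framePoint u x (L x) ∈ D
  upper_mem : ∀ x ∈ Set.Icc a b, framePoint u x (U x) ∈ D
  mem_Icc : ∀ p ∈ D, inner ℝ p u ∈ Set.Icc a b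
  lower_le : ∀ p ∈ D, L (inner ℝ p u) ≤ inner ℝ p (rot u)
  le_upper : ∀ p ∈ D, inner ℝ p (rot u) ≤ U (inner ℝ p u)

lemma exists_isRegionBetween {D : Set Plane} (hD : Convex ℝ D) (hc : IsCompact D)
    (hne : D.Nonempty) (hu : ‖u‖ = 1) :
    ∃ L U, IsRegionBetween D u (-supportFn D (-u)) (supportFn D u) L U := by
  let φ : Plane →L[ℝ] ℝ × ℝ :=
    ((innerSL ℝ).flip u).prod ((innerSL ℝ).flip (rot u))
  have hφ : ∀ p, φ p = (inner ℝ p u, inner ℝ p (rot u)) := fun p => rfl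
  have hmem : ∀ p ∈ D, inner ℝ p u ∈ Set.Icc (-supportFn D (-u)) (supportFn D u) := fun p hp => by
    have h1 := inner_le_supportFn hc hp (-u)
    rw [inner_neg_right] at h1
    exact ⟨by linarith, inner_le_supportFn hc hp u⟩
  obtain ⟨p₁, hp₁, hpe₁⟩ := exists_inner_eq_supportFn hc hne (-u)
  obtain ⟨p₂, hp₂, hpe₂⟩ := exists_inner_eq_supportFn hc hne u
  rw [inner_neg_right] at hpe₁
  have hab : -supportFn D (-u) ≤ supportFn D u := (hmem p₁ hp₁).1.trans (hmem p₁ hp₁).2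
  have hex : ∀ x ∈ Set.Icc (-supportFn D (-u)) (supportFn D u), ∃ y, (x, y) ∈ φ '' D := by
    intro x hx
    have h1 : inner ℝ p₁ u = -supportFn D (-u) := by linarith
    rw [← segment_eq_Icc hab, ← h1, ← hpe₂] at hx
    obtain ⟨α, β, hα, hβ, hαβ, rfl⟩ := hx
    refine ⟨inner ℝ (α • p₁ + β • p₂) (rot u), α • p₁ + β • p₂, hD hp₁ hp₂ hα hβ hαβ, ?_⟩
    rw [hφ, inner_add_left, real_inner_smul_left, real_inner_smul_left]
    rfl
  have hframe : ∀ x y, (x, y) ∈ φ '' D → framePoint u x y ∈ D := by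
    rintro x y ⟨p, hp, he⟩
    rw [hφ, Prod.mk.injEq] at he
    rw [← he.1, ← he.2, framePoint_inner hu]
    exact hp
  have hS : Convex ℝ (φ '' D) := hD.linear_image φ.toLinearMap
  have hSc : IsCompact (φ '' D) := hc.image φ.continuous
  have hfst : ∀ z ∈ φ '' D, z.1 ∈ Set.Icc (-supportFn D (-u)) (supportFn D u) := by
    rintro _ ⟨p, hp, rfl⟩
    exact hmem p hp
  obtain ⟨U, hU1, hU2, hU3⟩ := exists_upper_boundary hab hS hSc hfst hex
  obtain ⟨L, hL1, hL2, hL3⟩ := exists_lower_boundary hab hS hSc hfst hex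
  exact ⟨L, U, hu, hL1, hU1, fun x hx => hframe _ _ (hL2 x hx), fun x hx => hframe _ _ (hU2 x hx),
    hmem, fun p hp => hL3 _ ⟨p, hp, rfl⟩, fun p hp => hU3 _ ⟨p, hp, rfl⟩⟩

namespace IsRegionBetween

variable {D : Set Plane} {a b : ℝ} {L U : ℝ → ℝ}

lemma lower_le_upper (h : IsRegionBetween D u a b L U) {x : ℝ} (hx : x ∈ Set.Icc a b) :
    L x ≤ U x := by
  have := h.lower_le _ (h.upper_mem x hx)
  rwa [inner_framePoint h.norm_eq, inner_framePoint_rot h.norm_eq] at this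

lemma of_mem_interior (h : IsRegionBetween D u a b L U) {x y : ℝ}
    (hp : framePoint u x y ∈ interior D) : x ∈ Set.Ioo a b ∧ y ∈ Set.Ioo (L x) (U x) := by
  have hnhds : {z : ℝ × ℝ | framePoint u z.1 z.2 ∈ D} ∈ nhds (x, y) :=
    (continuous_framePoint u).continuousAt.preimage_mem_nhds (mem_interior_iff_mem_nhds.1 hp)
  obtain ⟨ε, hε, hball⟩ := Metric.mem_nhds_iff.1 hnhds
  have key : ∀ s t : ℝ, |s| ≤ 1 → |t| ≤ 1 → framePoint u (x + s * (ε / 2)) (y + t * (ε / 2)) ∈ D := by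
    intro s t hs ht
    refine hball (a := (x + s * (ε / 2), y + t * (ε / 2))) ?_
    rw [Metric.mem_ball, Prod.dist_eq]
    simp only [dist_self_add_left, Real.norm_eq_abs, abs_mul, abs_of_pos (half_pos hε)]
    exact max_lt (by nlinarith) (by nlinarith)
  have h1 := h.mem_Icc _ (key 1 0 (by norm_num) (by norm_num))
  have h2 := h.mem_Icc _ (key (-1) 0 (by norm_num) (by norm_num))
  have h3 := h.le_upper _ (key 0 1 (by norm_num) (by norm_num))
  have h4 := h.lower_le _ (key 0 (-1) (by norm_num) (by norm_num))
  simp only [inner_framePoint h.norm_eq, inner_framePoint_rot h.norm_eq, zero_mul, add_zero]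
    at h1 h2 h3 h4
  exact ⟨⟨by linarith [h2.1], by linarith [h1.2]⟩, by linarith, by linarith⟩

/-- A functional supporting `D` at the point would vanish on `rot u`, since the vertical chord
extends to both sides, then on `u`, since `D` reaches both `a` and `b`; so it would be zero. -/
lemma mem_interior (h : IsRegionBetween D u a b L U) (hD : Convex ℝ D)
    (hi : (interior D).Nonempty) {x y : ℝ} (hx : x ∈ Set.Ioo a b) (hy : y ∈ Set.Ioo (L x) (U x)) :
    framePoint u x y ∈ interior D := by
  by_contra hcon
  obtain ⟨f, hf⟩ := geometric_hahn_banach_open_point hD.interior isOpen_interior hcon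
  have hle : ∀ p ∈ D, f p ≤ f (framePoint u x y) := by
    intro p hp
    have h1 : p ∈ closure (interior D) := by
      rw [hD.closure_interior_eq_closure_of_nonempty_interior hi]
      exact subset_closure hp
    have h2 : closure (interior D) ⊆ {q | f q ≤ f (framePoint u x y)} :=
      closure_minimal (fun q hq => (hf q hq).le) (isClosed_le f.continuous continuous_const)
    exact h2 h1
  have hexp : ∀ x y, f (framePoint u x y) = x * f u + y * f (rot u) := fun x y => by
    simp [framePoint]
  have hx' : x ∈ Set.Icc a b := Set.Ioo_subset_Icc_self hx
  have h1 := hle _ (h.upper_mem x hx')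
  have h2 := hle _ (h.lower_mem x hx')
  have hab : a ≤ b := (hx.1.trans hx.2).le
  have h3 := hle _ (h.lower_mem a ⟨le_rfl, hab⟩)
  have h4 := hle _ (h.lower_mem b ⟨hab, le_rfl⟩)
  rw [hexp, hexp] at h1 h2 h3 h4
  have hv : f (rot u) = 0 := by
    apply le_antisymm
    · by_contra! hc
      nlinarith [mul_pos hc (sub_pos.2 hy.2)]
    · by_contra! hc
      nlinarith [mul_pos (neg_pos.2 hc) (sub_pos.2 hy.1)]
  rw [hv, mul_zero, mul_zero, add_zero, add_zero] at h3 h4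
  have hu : f u = 0 := by
    apply le_antisymm
    · by_contra! hc
      nlinarith [mul_pos hc (sub_pos.2 hx.2)]
    · by_contra! hc
      nlinarith [mul_pos (neg_pos.2 hc) (sub_pos.2 hx.1)]
  obtain ⟨q, hq⟩ := hi
  have h5 := hf q hq
  rw [← framePoint_inner h.norm_eq q, hexp, hexp, hu, hv] at h5
  simp at h5

/-- A mix of an interior point, with positive weight, and a boundary point over `a` or `b` gives an
interior point over `x`. -/
lemma lower_lt_upper (h : IsRegionBetween D u a b L U) (hD : Convex ℝ D)
    (hi : (interior D).Nonempty) {x : ℝ} (hx : x ∈ Set.Ioo a b) : L x < U x := by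
  obtain ⟨q, hq⟩ := hi
  obtain ⟨c, hc, hxc⟩ : ∃ c ∈ Set.Icc a b, ∃ α β : ℝ, 0 < α ∧ 0 ≤ β ∧ α + β = 1 ∧
      α * inner ℝ q u + β * c = x := by
    have hq' := h.mem_Icc q (interior_subset hq)
    have hab : a ≤ b := (hx.1.trans hx.2).le
    rcases lt_trichotomy x (inner ℝ q u) with hlt | heq | hgt
    · have h0 : 0 < inner ℝ q u - a := by linarith [hx.1]
      refine ⟨a, ⟨le_rfl, hab⟩, (x - a) / (inner ℝ q u - a), 1 - (x - a) / (inner ℝ q u - a),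
        div_pos (by linarith [hx.1]) h0, ?_, by ring, ?_⟩
      · rw [sub_nonneg, div_le_one h0]; linarith
      · field_simp; ring
    · exact ⟨a, ⟨le_rfl, hab⟩, 1, 0, one_pos, le_rfl, by norm_num, by rw [heq]; ring⟩
    · have h0 : 0 < b - inner ℝ q u := by linarith [hx.2]
      refine ⟨b, ⟨hab, le_rfl⟩, (b - x) / (b - inner ℝ q u), 1 - (b - x) / (b - inner ℝ q u),
        div_pos (by linarith [hx.2]) h0, ?_, by ring, ?_⟩
      · rw [sub_nonneg, div_le_one h0]; linarith
      · field_simp; ring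
  obtain ⟨α, β, hα, hβ, hαβ, he⟩ := hxc
  have h1 := hD.combo_interior_self_mem_interior hq (h.upper_mem c hc) hα hβ hαβ
  rw [← framePoint_inner h.norm_eq q, framePoint_combo, he] at h1
  have h2 := (h.of_mem_interior h1).2
  exact h2.1.trans h2.2

end IsRegionBetween

/-! ### Sweeping by parallel chords. -/

/-- Sweep a region between two graphs by its chords. -/
noncomputable def chordSweep (u : Plane) (a b : ℝ) (L U : ℝ → ℝ) (s t : unitInterval) : Plane :=
  framePoint u (a + t * (b - a))
    (L (a + t * (b - a)) + s * (U (a + t * (b - a)) - L (a + t * (b - a))))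

namespace IsRegionBetween

variable {D : Set Plane} {a b : ℝ} {L U : ℝ → ℝ}

/-- The conditions at `a` and `b` collapse the first and last chords to points. The boundary
condition holds because the interior consists of the points strictly between the graphs over the
open interval. -/
lemma isSensorCurve_chordSweep (h : IsRegionBetween D u a b L U) (hD : Convex ℝ D)
    (hc : IsCompact D) (hi : (interior D).Nonempty) (ha : L a = U a) (hb : L b = U b) :
    IsSensorCurve D (chordSweep u a b L U) := by
  have hab : a < b := by
    obtain ⟨q, hq⟩ := hi
    rw [← framePoint_inner h.norm_eq q] at hq
    have := (h.of_mem_interior hq).1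
    exact this.1.trans this.2
  have hx : ∀ t : unitInterval, a + t * (b - a) ∈ Set.Icc a b := fun t =>
    ⟨by nlinarith [t.2.1], by nlinarith [t.2.2]⟩
  have hmem : ∀ s t, chordSweep u a b L U s t ∈ D := by
    intro s t
    have h1 := hD (h.lower_mem _ (hx t)) (h.upper_mem _ (hx t)) (sub_nonneg.2 s.2.2) s.2.1
      (sub_add_cancel 1 (s : ℝ))
    rw [framePoint_combo] at h1
    convert h1 using 1
    unfold chordSweep
    congr 1 <;> ring
  have hfr : ∀ s t, chordSweep u a b L U s t ∈ frontier D ↔ (s = 0 ∨ s = 1) ∨ (t = 0 ∨ t = 1) := by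
    intro s t
    rw [hc.isClosed.frontier_eq, Set.mem_sdiff, and_iff_right (hmem s t), ← not_iff_not, not_not]
    push Not
    have hs0 : s ≠ 0 ↔ (0 : ℝ) < s := by rw [← unitInterval.pos_iff_ne_zero]; rfl
    have hs1 : s ≠ 1 ↔ (s : ℝ) < 1 := by rw [← unitInterval.lt_one_iff_ne_one]; rfl
    have ht0 : t ≠ 0 ↔ (0 : ℝ) < t := by rw [← unitInterval.pos_iff_ne_zero]; rfl
    have ht1 : t ≠ 1 ↔ (t : ℝ) < 1 := by rw [← unitInterval.lt_one_iff_ne_one]; rfl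
    rw [hs0, hs1, ht0, ht1]
    constructor
    · intro hp
      obtain ⟨⟨h1, h2⟩, h3, h4⟩ := h.of_mem_interior hp
      have h5 := h.lower_le_upper (hx t)
      refine ⟨⟨?_, ?_⟩, ?_, ?_⟩ <;> nlinarith
    · rintro ⟨⟨h1, h2⟩, h3, h4⟩
      have hx' : a + t * (b - a) ∈ Set.Ioo a b := ⟨by nlinarith, by nlinarith⟩
      have h5 := h.lower_lt_upper hD hi hx'
      exact h.mem_interior hD hi hx' ⟨by nlinarith, by nlinarith⟩
  have hxc : Continuous fun t : unitInterval => a + t * (b - a) := by fun_prop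
  have hLc : Continuous fun t : unitInterval => L (a + t * (b - a)) :=
    h.continuousOn_lower.comp_continuous hxc hx
  have hUc : Continuous fun t : unitInterval => U (a + t * (b - a)) :=
    h.continuousOn_upper.comp_continuous hxc hx
  refine ⟨?_, hmem, fun t _ _ => ?_, fun t h0 h1 => ?_, ?_, ?_, hfr⟩
  · refine (continuous_framePoint u).comp ((hxc.comp continuous_snd).prodMk ?_)
    exact (hLc.comp continuous_snd).add ((continuous_subtype_val.comp continuous_fst).mul
      ((hUc.comp continuous_snd).sub (hLc.comp continuous_snd)))
  · have h1 : (fun s => chordSweep u a b L U s t) = fun s : unitInterval =>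
        framePoint u (a + t * (b - a)) (L (a + t * (b - a))) +
          (s : ℝ) • ((U (a + t * (b - a)) - L (a + t * (b - a))) • rot u) := by
      funext s
      unfold chordSweep framePoint
      module
    rw [h1]
    exact ((eVariationOn_affine_le _ _).trans_lt ENNReal.ofReal_lt_top).ne
  · intro s s' hss
    have h2 := congrArg (fun p => inner ℝ p (rot u)) hss
    simp only [chordSweep, inner_framePoint_rot h.norm_eq] at h2
    have h0' : (0 : ℝ) < t := h0
    have h1' : (t : ℝ) < 1 := h1
    have h3 := h.lower_lt_upper hD hi (x := a + t * (b - a)) ⟨by nlinarith, by nlinarith⟩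
    exact Subtype.ext (mul_right_cancel₀ (sub_pos.2 h3).ne' (add_left_cancel h2))
  · refine ⟨chordSweep u a b L U 0 0, (hfr 0 0).2 (by simp), fun s => ?_⟩
    simp [chordSweep, ha]
  · refine ⟨chordSweep u a b L U 0 1, (hfr 0 1).2 (by simp), fun s => ?_⟩
    simp [chordSweep, hb]

lemma isSweep_chordSweep (h : IsRegionBetween D u a b L U) (hD : Convex ℝ D)
    (hc : IsCompact D) (hi : (interior D).Nonempty) (ha : L a = U a) (hb : L b = U b) :
    IsSweep D (chordSweep u a b L U) := by
  refine ⟨h.isSensorCurve_chordSweep hD hc hi ha hb, fun γ hγ hγD => ?_⟩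
  -- The moving line starts on one side of the intruder and ends on the other, so it meets the
  -- intruder at some time; the chord is all of `D` on that line.
  have hF : Continuous fun t : unitInterval => inner ℝ (γ t) u - (a + t * (b - a)) := by fun_prop
  obtain ⟨t, ht⟩ := mem_range_of_exists_le_of_exists_ge hF (c := 0)
    ⟨1, by have := (h.mem_Icc _ (hγD 1)).2; simp; linarith⟩
    ⟨0, by have := (h.mem_Icc _ (hγD 0)).1; simp; linarith⟩
  have hx : inner ℝ (γ t) u = a + t * (b - a) := sub_eq_zero.1 ht
  have h1 : inner ℝ (γ t) (rot u) ∈ Set.Icc (L (a + t * (b - a))) (U (a + t * (b - a))) := by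
    rw [← hx]
    exact ⟨h.lower_le _ (hγD t), h.le_upper _ (hγD t)⟩
  rw [← segment_eq_Icc (h1.1.trans h1.2), segment_eq_image'] at h1
  obtain ⟨s, hs, hse⟩ := h1
  refine ⟨t, ⟨s, hs⟩, ?_⟩
  rw [← framePoint_inner h.norm_eq (γ t), hx, ← hse]
  rfl

lemma sweepingCost_le (h : IsRegionBetween D u a b L U) (hD : Convex ℝ D)
    (hc : IsCompact D) (hi : (interior D).Nonempty) (ha : L a = U a) (hb : L b = U b) {ℓ : ℝ}
    (hℓ : ∀ x ∈ Set.Icc a b, U x - L x ≤ ℓ) : sweepingCost D ≤ ENNReal.ofReal ℓ := by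
  refine (iInf₂_le _ (h.isSweep_chordSweep hD hc hi ha hb)).trans (iSup_le fun t => ?_)
  have hab : a ≤ b := by
    obtain ⟨q, hq⟩ := hi
    exact (h.mem_Icc q (interior_subset hq)).1.trans (h.mem_Icc q (interior_subset hq)).2
  have hx : a + t * (b - a) ∈ Set.Icc a b :=
    ⟨by nlinarith [t.2.1], by nlinarith [t.2.2]⟩
  have h1 : (fun s => chordSweep u a b L U s t) = fun s : unitInterval =>
      framePoint u (a + t * (b - a)) (L (a + t * (b - a))) +
        (s : ℝ) • ((U (a + t * (b - a)) - L (a + t * (b - a))) • rot u) := by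
    funext s
    unfold chordSweep framePoint
    module
  rw [h1]
  refine (eVariationOn_affine_le _ _).trans (ENNReal.ofReal_le_ofReal ?_)
  rw [norm_smul, norm_rot, h.norm_eq, mul_one,
    Real.norm_of_nonneg (sub_nonneg.2 (h.lower_le_upper hx))]
  exact hℓ _ hx

end IsRegionBetween

end frame

/-! ### The sweeping cost is at most the width. -/

lemma rot_unitVec (θ : ℝ) : rot (unitVec θ) = unitVec (θ + Real.pi / 2) := by
  apply Plane.ext <;> simp [Real.cos_add_pi_div_two, Real.sin_add_pi_div_two]

section width

variable {D : Set Plane}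

lemma ae_subsingleton_opposite_faces (hc : IsCompact D) (hne : D.Nonempty) :
    ∀ᵐ θ : ℝ, ∀ n, (n = unitVec θ ∨ n = -unitVec θ) → ∀ p ∈ D, ∀ q ∈ D,
      inner ℝ p n = supportFn D n → inner ℝ q n = supportFn D n → p = q := by
  have h1 := ae_subsingleton_face hc hne
  -- The opposite direction is a shift by `π`, which preserves null sets.
  have h2 := (measurePreserving_add_right (volume : Measure ℝ) Real.pi).quasiMeasurePreserving.ae h1
  filter_upwards [h1, h2] with θ h3 h4
  rintro n (rfl | rfl)
  · exact h3
  · rw [← unitVec_add_pi]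
    exact h4

/-- Chords parallel to `rot (unitVec θ)` project to the direction `rot (unitVec φ)` with factor `cos
(θ - φ)`, and the projection is at most the width there. -/
lemma sweepingCost_le_of_subsingleton_faces (hD : Convex ℝ D) (hc : IsCompact D)
    (hi : (interior D).Nonempty) {θ φ : ℝ}
    (hface : ∀ n, (n = unitVec θ ∨ n = -unitVec θ) → ∀ p ∈ D, ∀ q ∈ D,
      inner ℝ p n = supportFn D n → inner ℝ q n = supportFn D n → p = q)
    (hcos : 0 < Real.cos (θ - φ)) :
    sweepingCost D ≤ ENNReal.ofReal ((supportFn D (rot (unitVec φ)) +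
      supportFn D (-rot (unitVec φ))) / Real.cos (θ - φ)) := by
  have hne : D.Nonempty := hi.mono interior_subset
  have hu : ‖unitVec θ‖ = 1 := norm_unitVec θ
  obtain ⟨L, U, h⟩ := exists_isRegionBetween hD hc hne hu
  have hab : -supportFn D (-unitVec θ) ≤ supportFn D (unitVec θ) := by
    obtain ⟨q, hq⟩ := hne
    exact (h.mem_Icc q hq).1.trans (h.mem_Icc q hq).2
  have heq : ∀ x y y', framePoint (unitVec θ) x y = framePoint (unitVec θ) x y' → y = y' := by
    intro x y y' he
    have := congrArg (fun p => inner ℝ p (rot (unitVec θ))) he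
    simpa only [inner_framePoint_rot hu] using this
  refine h.sweepingCost_le hD hc hi ?_ ?_ fun x hx => ?_
  · refine heq _ _ _ (hface _ (Or.inr rfl) _ (h.lower_mem _ ⟨le_rfl, hab⟩) _
      (h.upper_mem _ ⟨le_rfl, hab⟩) ?_ ?_) <;>
    rw [inner_neg_right, inner_framePoint hu, neg_neg]
  · refine heq _ _ _ (hface _ (Or.inl rfl) _ (h.lower_mem _ ⟨hab, le_rfl⟩) _
      (h.upper_mem _ ⟨hab, le_rfl⟩) ?_ ?_) <;>
    rw [inner_framePoint hu]
  · rw [le_div_iff₀ hcos]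
    have h1 := inner_le_supportFn hc (h.upper_mem x hx) (rot (unitVec φ))
    have h2 := inner_le_supportFn hc (h.lower_mem x hx) (-rot (unitVec φ))
    have h3 : inner ℝ (rot (unitVec θ)) (rot (unitVec φ)) = Real.cos (θ - φ) := by
      rw [Plane.inner_eq, Real.cos_sub]
      simp
      ring
    rw [inner_neg_right] at h2
    simp only [framePoint, inner_add_left, real_inner_smul_left, h3] at h1 h2
    linarith

/-- The sweeping cost of a plane convex body is at most its width in any direction. -/
lemma sweepingCost_le_width (hD : Convex ℝ D) (hc : IsCompact D) (hi : (interior D).Nonempty)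
    {n : Plane} (hn : ‖n‖ = 1) :
    sweepingCost D ≤ ENNReal.ofReal (supportFn D n + supportFn D (-n)) := by
  obtain ⟨ψ, hψ⟩ := exists_unitVec_eq hn
  obtain ⟨φ, rfl⟩ : ∃ φ, n = rot (unitVec φ) :=
    ⟨ψ - Real.pi / 2, by rw [rot_unitVec, sub_add_cancel, hψ]⟩
  set w := supportFn D (rot (unitVec φ)) + supportFn D (-rot (unitVec φ))
  -- Admissible angles have full measure, hence are dense: `θ → φ` along them sends the cosine to
  -- `1`.
  have hdense := Measure.dense_of_ae
    (ae_subsingleton_opposite_faces hc (hi.mono interior_subset))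
  set G := {θ : ℝ | ∀ n, (n = unitVec θ ∨ n = -unitVec θ) → ∀ p ∈ D, ∀ q ∈ D,
    inner ℝ p n = supportFn D n → inner ℝ q n = supportFn D n → p = q}
  have := mem_closure_iff_nhdsWithin_neBot.1 (hdense φ)
  have hcos : ContinuousAt (fun θ => Real.cos (θ - φ)) φ := by fun_prop
  have hcont : ContinuousAt (fun θ => ENNReal.ofReal (w / Real.cos (θ - φ))) φ :=
    ENNReal.continuous_ofReal.continuousAt.comp
      (continuousAt_const.div hcos (by simp))
  have hpos : ∀ᶠ θ in nhds φ, 0 < Real.cos (θ - φ) :=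
    hcos.eventually (lt_mem_nhds (by simp))
  have hev : ∀ᶠ θ in nhdsWithin φ G,
      sweepingCost D ≤ ENNReal.ofReal (w / Real.cos (θ - φ)) := by
    filter_upwards [self_mem_nhdsWithin, nhdsWithin_le_nhds hpos] with θ h1 h2
    exact sweepingCost_le_of_subsingleton_faces hD hc hi h1 h2
  have hlim := ge_of_tendsto (hcont.tendsto.mono_left nhdsWithin_le_nhds) hev
  simpa using hlim

theorem sweepingCost_sq_div_le_volume (hD : Convex ℝ D) (hc : IsCompact D)
    (hi : (interior D).Nonempty) :
    sweepingCost D ^ 2 / ENNReal.ofReal (√3) ≤ volume D := by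
  have hcont := continuous_supportFn hc
  obtain ⟨n, hn, hmin⟩ := (isCompact_sphere (0 : Plane) 1).exists_isMinOn
    ⟨unitVec 0, by simp⟩ (f := fun n => supportFn D n + supportFn D (-n))
    (by fun_prop)
  have hn1 : ‖n‖ = 1 := by simpa using hn
  have hw0 : 0 ≤ supportFn D n + supportFn D (-n) := by
    obtain ⟨q, hq⟩ := hi.mono interior_subset
    have h1 := inner_le_supportFn hc hq n
    have h2 := inner_le_supportFn hc hq (-n)
    rw [inner_neg_right] at h2
    linarith
  have hpal := pal_inequality hD hc hi hw0 fun m hm => hmin (by simpa using hm)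
  refine le_trans ?_ hpal
  rw [ENNReal.ofReal_div_of_pos (by positivity), ENNReal.ofReal_pow hw0]
  gcongr
  exact sweepingCost_le_width hD hc hi hn1

end width

/-! ### Equality for equilateral triangles and extremality. -/

lemma IsEquilateral.volume_eq {V : Fin 3 → Plane} {ℓ : ℝ} (h : IsEquilateral V ℓ) :
    volume (convexHull ℝ (Set.range V)) =
      sweepingCost (convexHull ℝ (Set.range V)) ^ 2 / ENNReal.ofReal (√3) := by
  refine le_antisymm ?_ (sweepingCost_sq_div_le_volume (convex_convexHull ℝ _)
    (IsEquilateral.isCompact_triangle V) h.interior_triangle_nonempty)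
  have h0 : 0 ≤ √3 / 2 * ℓ := mul_nonneg (by positivity) h.pos.le
  have h1 : √3 / 4 * ℓ ^ 2 = (√3 / 2 * ℓ) ^ 2 / √3 := by
    have : √3 ≠ 0 := by positivity
    field_simp
    norm_num
    ring
  rw [h.volume_triangle, h1, ENNReal.ofReal_div_of_pos (by positivity), ENNReal.ofReal_pow h0]
  gcongr
  exact h.le_sweepingCost

lemma exists_isEquilateral {ℓ : ℝ} (hℓ : 0 < ℓ) : ∃ V, IsEquilateral V ℓ := by
  have h3 : (√3) ^ 2 = 3 := Real.sq_sqrt (by norm_num)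
  have hs3 : 0 < √3 := by positivity
  -- Alternate vertices of the regular hexagon of circumradius `1` are at distance `√3`.
  refine ⟨fun i => (ℓ / √3) • hexVec ((![0, 2, 4] : Fin 3 → Fin 6) i), hℓ, fun i j hij => ?_⟩
  rw [dist_eq_norm, ← smul_sub, norm_smul, Real.norm_of_nonneg (by positivity)]
  have h : ‖hexVec ((![0, 2, 4] : Fin 3 → Fin 6) i) - hexVec ((![0, 2, 4] : Fin 3 → Fin 6) j)‖ ^ 2 =
      (√3) ^ 2 := by
    rw [Plane.norm_sq_eq]
    fin_cases i <;> fin_cases j <;> simp [hexVec] at hij ⊢ <;> nlinarith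
  rw [(pow_left_inj₀ (norm_nonneg _) hs3.le two_ne_zero).1 h, div_mul_cancel₀ _ hs3.ne']

lemma exists_isEquilateralTriangle_volume_eq {A : ℝ} (hA : 0 < A) :
    ∃ T : Set Plane, IsEquilateralTriangle T ∧ volume T = ENNReal.ofReal A := by
  have hs3 : 0 < √3 := by positivity
  obtain ⟨V, h⟩ := exists_isEquilateral (ℓ := √(4 * A / √3)) (by positivity)
  refine ⟨_, h.isEquilateralTriangle, ?_⟩
  rw [h.volume_triangle, Real.sq_sqrt (by positivity)]
  congr 1
  field_simp

theorem mainTheorem4 :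
    (∀ D : Set Plane, IsJordanDomain D → Convex ℝ D →
      sweepingCost D ^ 2 / ENNReal.ofReal (√3) ≤ volume D) ∧
    (∀ T : Set Plane, IsEquilateralTriangle T →
      volume T = sweepingCost T ^ 2 / ENNReal.ofReal (√3)) ∧
    (∀ A : ℝ, 0 < A →
      (∃ T : Set Plane, IsEquilateralTriangle T ∧ volume T = ENNReal.ofReal A) ∧
      ∀ T : Set Plane, IsEquilateralTriangle T → volume T = ENNReal.ofReal A →
        IsGreatest
          {c : ℝ≥0∞ | ∃ D : Set Plane, IsJordanDomain D ∧ Convex ℝ D ∧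
            volume D = ENNReal.ofReal A ∧ c = sweepingCost D}
          (sweepingCost T)) := by
  have hineq : ∀ D : Set Plane, IsJordanDomain D → Convex ℝ D →
      sweepingCost D ^ 2 / ENNReal.ofReal (√3) ≤ volume D := fun D hJ hD =>
    sweepingCost_sq_div_le_volume hD hJ.isCompact (hJ.interior_nonempty hD)
  have heq : ∀ T : Set Plane, IsEquilateralTriangle T →
      volume T = sweepingCost T ^ 2 / ENNReal.ofReal (√3) := by
    intro T hT
    obtain ⟨V, ℓ, h, rfl⟩ := hT.exists_isEquilateral
    exact h.volume_eq
  refine ⟨hineq, heq, fun A hA => ⟨exists_isEquilateralTriangle_volume_eq hA,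
    fun T hT hTA => ⟨?_, ?_⟩⟩⟩
  · obtain ⟨V, ℓ, h, rfl⟩ := hT.exists_isEquilateral
    exact ⟨_, (convex_convexHull ℝ _).isJordanDomain (IsEquilateral.isCompact_triangle V)
      h.interior_triangle_nonempty, convex_convexHull ℝ _, hTA, rfl⟩
  · rintro c ⟨D, hJ, hD, hDA, rfl⟩
    have h1 := hineq D hJ hD
    rw [hDA, ← hTA, heq T hT] at h1
    have h0 : ENNReal.ofReal (√3) ≠ 0 := by simp
    -- Multiplying by `√3`, which is neither `0` nor `∞`, and taking square roots in `[0, ∞]` needs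
    -- no finiteness of the costs.
    have h2 := mul_le_mul_left h1 (ENNReal.ofReal (√3))
    rw [ENNReal.div_mul_cancel h0 ENNReal.ofReal_ne_top,
      ENNReal.div_mul_cancel h0 ENNReal.ofReal_ne_top] at h2
    exact (ENNReal.pow_le_pow_left_iff two_ne_zero).1 h2
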